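/- Let $\mathcal E$ be a category with finite limits. *Polynomials.* A morphism $f\colon A\to B$ of $\mathcal E$ is *exponentiable* if pullback along it, $\Delta_f\colon\mathcal E/B\to\mathcal E/A$, has a right adjoint $\Pi_f$. A *polynomial* in $\mathcal E$ is an exponentiable morphism $p\colon P_*\to P$. A morphism $\phi\colon p\to q$ consists of $\phi_1\colon P\to Q$ and $\phi^\sharp\colon P\times_Q Q_*\to P_*$ over $P$ (up to isomorphism of the chosen pullback); it is *cartesian* if $\phi^\sharp$ is invertible. The composite of $\phi\colon p\to q$ and $\psi\colon q\to r$ is $\psi_1\phi_1$ on $P$ and $(x,e)\mapsto\phi^\sharp(x,\psi^\sharp(\phi_1x,e))$ on $P\times_R R_*$. This gives a category $\mathrm{Poly}_{\mathcal E}$. A polynomial $p$ induces the endofunctor $\mathbf P(p)$ of $\mathcal E$ sending $A$ to the domain of $\Pi_p(A\times P_*\to P_*)$, whose generalized elements are pairs $(x,g)$ with $x$ in $P$ and $g$ a map from the fibre of $p$ over $x$ to $A$; a morphism $\phi\colon p\to q$ induces the natural transformation $\mathbf P(\phi)\colon(x,g)\mapsto(\phi_1x,\,g\circ\phi^\sharp(x,-))$.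 The composition product $p\triangleleft q$ is the composite $$(\mathbf P(p)(Q)\times_P P_*)\times_Q Q_*\to \mathbf P(p)(Q)\times_P P_*\to\mathbf P(p)(Q),$$ the first pullback being along the evaluation map $\mathbf P(p)(Q)\times_P P_*\to Q$. With $\triangleleft$ and $y=\mathrm{id}_1$, $\mathrm{Poly}_{\mathcal E}$ is a monoidal category, and $\mathbf P(p\triangleleft q)\cong\mathbf P(p)\circ\mathbf P(q)$, $\mathbf P(y)\cong\mathrm{id}$ naturally. *Comonoids and coalgebras.* Let $c\colon C_*\to C$, with $\epsilon\colon c\to y$ and $\delta\colon c\to c\triangleleft c$, be a comonoid in $(\mathrm{Poly}_{\mathcal E},y,\triangleleft)$. Then $\mathbf P(c)$ is a comonad on $\mathcal E$ with counit $\mathbf P(c)\to\mathbf P(y)\cong\mathrm{id}$ and comultiplication $\mathbf P(c)\to\mathbf P(c\triangleleft c)\cong\mathbf P(c)\circ\mathbf P(c)$. A $c$-coalgebra is a coalgebra of this comonad, that is, a map $\kappa\colon S\to\mathbf P(c)(S)$ satisfying the counit and comultiplication equations; a homomorphism is a morphism of $\mathcal E$ commuting with the maps $\kappa$. *Internal categories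 and copresheaves.* The comonoid $c$ is regarded as the category internal to $\mathcal E$ with objects $C$, morphisms $C_*$ and source $c$; its identities are given by $\epsilon^\sharp$; the target of a morphism $f$ out of $x$ is the value of $\delta_1(x)\in\mathbf P(c)(C)$ at $f$; and the composite of $f$ out of $x$ with $g$ out of the target of $f$ is $\delta^\sharp(x,(f,g))$. For categories $\mathcal D,\mathcal C$ internal to $\mathcal E$, an *internal cofunctor* $\phi\colon\mathcal D\to\mathcal C$ consists of $\phi_1\colon D_0\to C_0$ and $\phi^\sharp\colon D_0\times_{C_0}C_1\to D_1$ over $D_0$ (the pullback being formed with the source map of $\mathcal C$) such that $\phi^\sharp(x,\mathrm{id}_{\phi_1x})=\mathrm{id}_x$; $\phi_1(t\,\phi^\sharp(x,e))=t(e)$; and, whenever $t(e)=s(e')$, the morphism $\phi^\sharp(x,e'\circ e)$ is $\phi^\sharp(t\,\phi^\sharp(x,e),e')\circ\phi^\sharp(x,e)$. Cofunctors are composed by the formula for morphisms of polynomials. An *internal copresheaf* (internal discrete opfibration) on $\mathcal C$ is an internal cofunctor $\phi\colon\mathcal D\to\mathcal C$ from an internal category $\mathcal D$ with $\phi^\sharp$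 invertible; a morphism of internal copresheaves on $\mathcal C$ is an internal cofunctor $\mathcal D\to\mathcal D'$ commuting with the cofunctors to $\mathcal C$. **Theorem.** Let $\mathcal E$ be a category with finite limits and let $c$ be a comonoid in $(\mathrm{Poly}_{\mathcal E},y,\triangleleft)$. Then the category of $c$-coalgebras is equivalent to the category of internal copresheaves on the category internal to $\mathcal E$ given by $c$. -/

import Mathlib

open CategoryTheory Limits MonoidalCategory MonoidalOpposite

universe v u

namespace InternalPoly

attribute [local simp] pullback.lift_fst pullback.lift_snd pullback.lift_fst_assoc
  pullback.lift_snd_assoc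

section Exponentiable

variable {E : Type u} [Category.{v} E] [HasFiniteLimits E]

/-- A morphism is exponentiable if pulling back along it has a right adjoint. -/
def Exponentiable {B A : E} (f : B ⟶ A) : Prop := (Over.pullback f).IsLeftAdjoint

theorem Exponentiable.id (A : E) : Exponentiable (𝟙 A) :=
  (Adjunction.id.ofNatIsoLeft Over.pullbackId.symm).isLeftAdjoint

theorem Exponentiable.comp {C B A : E} {g : C ⟶ B} {f : B ⟶ A}
    (hg : Exponentiable g) (hf : Exponentiable f) : Exponentiable (g ≫ f) := by
  have : (Over.pullback g).IsLeftAdjoint := hg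
  have : (Over.pullback f).IsLeftAdjoint := hf
  exact ((Adjunction.ofIsLeftAdjoint (Over.pullback f ⋙ Over.pullback g)).ofNatIsoLeft
    (Over.pullbackComp g f).symm).isLeftAdjoint

/-- The unit of `Σ_f ⊣ Δ_f` is a regular monomorphism. -/
noncomputable def regularMonoUnit {B A : E} (f : B ⟶ A) (X : Over B) :
    RegularMono ((Over.mapPullbackAdj f).unit.app X) := by
  let a : pullback (X.hom ≫ f) f ⟶ X.left := pullback.fst (X.hom ≫ f) f
  let b : pullback (X.hom ≫ f) f ⟶ B := pullback.snd (X.hom ≫ f) f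
  have hab : (a ≫ X.hom) ≫ f = b ≫ f := (Category.assoc _ _ _).trans pullback.condition
  let l : pullback (X.hom ≫ f) f ⟶ pullback f f := pullback.lift (a ≫ X.hom) b hab
  let r : pullback (X.hom ≫ f) f ⟶ pullback f f := pullback.lift b b rfl
  let n : X.left ⟶ pullback (X.hom ≫ f) f :=
    pullback.lift (𝟙 _) X.hom (Category.id_comp _)
  have na : n ≫ a = 𝟙 _ := pullback.lift_fst _ _ _
  have nb : n ≫ b = X.hom := pullback.lift_snd _ _ _
  have la : l ≫ pullback.fst f f = a ≫ X.hom := pullback.lift_fst _ _ _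
  have lb : l ≫ pullback.snd f f = b := pullback.lift_snd _ _ _
  have ra : r ≫ pullback.fst f f = b := pullback.lift_fst _ _ _
  have rb : r ≫ pullback.snd f f = b := pullback.lift_snd _ _ _
  have ext' : ∀ {T : E} (s t : T ⟶ pullback (X.hom ≫ f) f), s ≫ a = t ≫ a → s ≫ b = t ≫ b →
    s = t := fun s t h h' => pullback.hom_ext h h'
  have key : n ≫ l = n ≫ r := by
    apply pullback.hom_ext
    · rw [Category.assoc, Category.assoc, la, ra, nb, reassoc_of% na]
    · rw [Category.assoc, Category.assoc, lb, rb]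
  let L : Over.mk b ⟶ Over.mk (pullback.snd f f) := Over.homMk l lb
  let R : Over.mk b ⟶ Over.mk (pullback.snd f f) := Over.homMk r rb
  let N : X ⟶ Over.mk b := Over.homMk n nb
  have hNLR : N ≫ L = N ≫ R := Over.OverMorphism.ext key
  have lim : IsLimit (Fork.ofι N hNLR) := Fork.IsLimit.mk' _ fun s => by
    let i : s.pt.left ⟶ pullback (X.hom ≫ f) f := s.ι.left
    have hs : i ≫ l = i ≫ r := congrArg CommaMorphism.left s.condition
    have h1 : i ≫ a ≫ X.hom = i ≫ b := by
      have := congrArg (· ≫ pullback.fst f f) hs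
      simpa only [Category.assoc, la, ra] using this
    have hw : i ≫ b = s.pt.hom := Over.w s.ι
    have hw' : (i ≫ a) ≫ X.hom = s.pt.hom := (Category.assoc _ _ _).trans (h1.trans hw)
    refine ⟨Over.homMk (i ≫ a) hw', ?_, ?_⟩
    · apply Over.OverMorphism.ext
      change (i ≫ a) ≫ n = i
      apply ext'
      · rw [Category.assoc, Category.assoc, na, Category.comp_id]
      · rw [Category.assoc, Category.assoc, nb, h1]
    · intro m hm
      apply Over.OverMorphism.ext
      let m' : s.pt.left ⟶ X.left := m.left
      change m' = i ≫ a
      have : m' ≫ n = i := congrArg CommaMorphism.left hm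
      rw [← this, Category.assoc, na, Category.comp_id]
  have hN : (Over.mapPullbackAdj f).unit.app X = N :=
    Over.OverMorphism.ext (by simp [N, n])
  rw [hN]
  exact
    { Z := Over.mk (pullback.snd f f)
      left := L
      right := R
      w := hNLR
      isLimit := lim }

/-- Exponentiable morphisms are stable under pullback. -/
theorem Exponentiable.of_isPullback {B' B A' A : E} {g : B' ⟶ B} {f' : B' ⟶ A'} {f : B ⟶ A}
    {h : A' ⟶ A} (sq : IsPullback g f' f h) (hf : Exponentiable f) : Exponentiable f' := by
  have : (Over.pullback f).IsLeftAdjoint := hf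
  let F : ∀ {X : E} (x : X ⟶ A'), pullback (x ≫ h) f ⟶ pullback x f' := fun x =>
    pullback.lift (pullback.fst (x ≫ h) f)
      (sq.lift (pullback.snd (x ≫ h) f) (pullback.fst (x ≫ h) f ≫ x)
        (by simp [pullback.condition])) (by simp)
  let G : ∀ {X : E} (x : X ⟶ A'), pullback x f' ⟶ pullback (x ≫ h) f := fun x =>
    pullback.lift (pullback.fst x f') (pullback.snd x f' ≫ g)
      (by simp [pullback.condition_assoc, sq.w])
  have FG : ∀ {X : E} (x : X ⟶ A'), F x ≫ G x = 𝟙 _ := fun x => by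
    apply pullback.hom_ext <;> simp [F, G]
  have GF : ∀ {X : E} (x : X ⟶ A'), G x ≫ F x = 𝟙 _ := fun x => by
    apply pullback.hom_ext
    · simp [F, G]
    · apply sq.hom_ext <;> simp [F, G, pullback.condition]
  have hF : ∀ {X : E} (x : X ⟶ A'), (F x ≫ pullback.snd x f') ≫ g = pullback.snd (x ≫ h) f :=
    fun x => by simp [F]
  have nat : ∀ {X Y : E} (x : X ⟶ A') (y : Y ⟶ A') (k : X ⟶ Y) (w : k ≫ y = x),
      pullback.lift (pullback.fst (x ≫ h) f ≫ k) (pullback.snd (x ≫ h) f)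
        (by rw [Category.assoc, reassoc_of% w, pullback.condition]) ≫ F y =
      F x ≫ pullback.lift (pullback.fst x f' ≫ k) (pullback.snd x f')
        (by rw [Category.assoc, w, pullback.condition]) := fun x y k w => by
    subst w
    apply pullback.hom_ext
    · simp [F]
    · apply sq.hom_ext <;> simp [F]
  let comm : Over.map h ⋙ Over.pullback f ≅ Over.pullback f' ⋙ Over.map g :=
    NatIso.ofComponents (fun X => Over.isoMk
      { hom := F X.hom
        inv := G X.hom
        hom_inv_id := FG X.hom
        inv_hom_id := GF X.hom }
      ((Category.assoc _ _ _).symm.trans (hF X.hom)))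
      (fun {X Y} k => Over.OverMorphism.ext (nat X.hom Y.hom k.left (Over.w k)))
  have := ((Adjunction.ofIsLeftAdjoint (Over.map h ⋙ Over.pullback f)).ofNatIsoLeft
    comm).isLeftAdjoint
  exact isLeftAdjoint_triangle_lift (Over.pullback f') (Over.mapPullbackAdj g)
    (fun X => regularMonoUnit g X)

end Exponentiable

section Polynomials

variable {E : Type u} [Category.{v} E] [HasFiniteLimits E]

/-- Morphisms between arrows `p : A ⟶ B` and `q : A' ⟶ B'`, going forwards on codomains
("positions") and backwards on domains ("directions"):
```
A <-- B ×_{B'} A' --> A'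
|p        |           |q
B ======= B --------> B'
```
The choice of the pullback `B ×_{B'} A'` is fixed to be `pullback onPos q`, which picks out exactly
one representative of each isomorphism class of such diagrams. -/
structure ArrowLens {A B A' B' : E} (p : A ⟶ B) (q : A' ⟶ B') where
  onPos : B ⟶ B'
  onDir : pullback onPos q ⟶ A
  onDir_comp : onDir ≫ p = pullback.fst onPos q

namespace ArrowLens

variable {A B A' B' A'' B'' : E} {p : A ⟶ B} {q : A' ⟶ B'} {r : A'' ⟶ B''}

/-- The action of `φ.onDir` on generalized elements: for `x` in `B` and `e` in `A'` over the image
of `x`, this is the element of `A` over `x` assigned to `(x, e)`. -/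
noncomputable def app (φ : ArrowLens p q) {T : E} (x : T ⟶ B) (e : T ⟶ A')
    (h : x ≫ φ.onPos = e ≫ q) : T ⟶ A :=
  pullback.lift x e h ≫ φ.onDir

@[simp]
theorem app_comp (φ : ArrowLens p q) {T : E} (x : T ⟶ B) (e : T ⟶ A')
    (h : x ≫ φ.onPos = e ≫ q) : φ.app x e h ≫ p = x := by
  simp [app, φ.onDir_comp]

@[simp]
theorem app_comp_assoc (φ : ArrowLens p q) {T : E} (x : T ⟶ B) (e : T ⟶ A')
    (h : x ≫ φ.onPos = e ≫ q) {Z : E} (k : B ⟶ Z) : φ.app x e h ≫ p ≫ k = x ≫ k := by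
  rw [← Category.assoc, φ.app_comp]

theorem comp_app (φ : ArrowLens p q) {S T : E} (s : S ⟶ T) (x : T ⟶ B) (e : T ⟶ A')
    (h : x ≫ φ.onPos = e ≫ q) :
    s ≫ φ.app x e h = φ.app (s ≫ x) (s ≫ e) (by simp [h]) := by
  rw [app, app, ← Category.assoc]
  congr 1
  apply pullback.hom_ext <;> simp

theorem app_congr {φ ψ : ArrowLens p q} (hφ : φ = ψ) {T : E} {x x' : T ⟶ B} {e e' : T ⟶ A'}
    (hx : x = x') (he : e = e') (h : x ≫ φ.onPos = e ≫ q) (h' : x' ≫ ψ.onPos = e' ≫ q) :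
    φ.app x e h = ψ.app x' e' h' := by
  subst hφ hx he; rfl

theorem app_fst_snd (φ : ArrowLens p q) :
    φ.app (pullback.fst φ.onPos q) (pullback.snd φ.onPos q) pullback.condition = φ.onDir := by
  rw [app, pullback.lift_fst_snd, Category.id_comp]

theorem ext {φ ψ : ArrowLens p q} (hpos : φ.onPos = ψ.onPos)
    (hdir : ∀ {T : E} (x : T ⟶ B) (e : T ⟶ A') (h : x ≫ φ.onPos = e ≫ q)
      (h' : x ≫ ψ.onPos = e ≫ q), φ.app x e h = ψ.app x e h') : φ = ψ := by
  obtain ⟨f, d, hd⟩ := φ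
  obtain ⟨f', d', hd'⟩ := ψ
  obtain rfl : f = f' := hpos
  obtain rfl : d = d' := by
    have := hdir (pullback.fst f q) (pullback.snd f q) pullback.condition pullback.condition
    simpa [app] using this
  rfl

/-- Build a morphism from its action on generalized elements. -/
@[simps onPos]
noncomputable def ofElements (f : B ⟶ B')
    (d : ∀ {T : E} (x : T ⟶ B) (e : T ⟶ A'), x ≫ f = e ≫ q → (T ⟶ A))
    (hd : ∀ {T : E} (x : T ⟶ B) (e : T ⟶ A') (h : x ≫ f = e ≫ q), d x e h ≫ p = x) :
    ArrowLens p q where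
  onPos := f
  onDir := d (pullback.fst f q) (pullback.snd f q) pullback.condition
  onDir_comp := hd _ _ _

theorem ofElements_app (f : B ⟶ B')
    (d : ∀ {T : E} (x : T ⟶ B) (e : T ⟶ A'), x ≫ f = e ≫ q → (T ⟶ A))
    (hd : ∀ {T : E} (x : T ⟶ B) (e : T ⟶ A') (h : x ≫ f = e ≫ q), d x e h ≫ p = x)
    (nat : ∀ {S T : E} (s : S ⟶ T) (x : T ⟶ B) (e : T ⟶ A') (h : x ≫ f = e ≫ q),
      s ≫ d x e h = d (s ≫ x) (s ≫ e) (by simp [h]))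
    {T : E} (x : T ⟶ B) (e : T ⟶ A') (h : x ≫ f = e ≫ q) :
    (ofElements f d hd).app x e h = d x e h := by
  refine (nat _ _ _ _).trans ?_
  have h1 := pullback.lift_fst x e h
  have h2 := pullback.lift_snd x e h
  congr 1

/-- The identity morphism. -/
@[simps onPos]
noncomputable def id (p : A ⟶ B) : ArrowLens p p where
  onPos := 𝟙 B
  onDir := pullback.snd (𝟙 B) p
  onDir_comp := by rw [← pullback.condition, Category.comp_id]

@[simp]
theorem id_app {T : E} (x : T ⟶ B) (e : T ⟶ A) (h : x ≫ (ArrowLens.id p).onPos = e ≫ p) :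
    (ArrowLens.id p).app x e h = e :=
  pullback.lift_snd _ _ _

/-- Composition, `(x, e) ↦ φ♯ (x, ψ♯ (φ x, e))` on directions. -/
@[simps onPos]
noncomputable def comp (φ : ArrowLens p q) (ψ : ArrowLens q r) : ArrowLens p r where
  onPos := φ.onPos ≫ ψ.onPos
  onDir := φ.app (pullback.fst (φ.onPos ≫ ψ.onPos) r)
    (ψ.app (pullback.fst (φ.onPos ≫ ψ.onPos) r ≫ φ.onPos) (pullback.snd (φ.onPos ≫ ψ.onPos) r)
      (by rw [Category.assoc, pullback.condition]))
    (by rw [app_comp])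
  onDir_comp := by rw [app_comp]

@[simp]
theorem comp_app' (φ : ArrowLens p q) (ψ : ArrowLens q r) {T : E} (x : T ⟶ B) (e : T ⟶ A'')
    (h : x ≫ (φ.comp ψ).onPos = e ≫ r) :
    (φ.comp ψ).app x e h =
      φ.app x (ψ.app (x ≫ φ.onPos) e (by rw [Category.assoc, ← h, comp_onPos]))
        (by rw [app_comp]) := by
  refine (comp_app φ (pullback.lift x e h) _ _ _).trans (app_congr rfl ?_ ?_ _ _)
  · exact pullback.lift_fst _ _ _
  · refine (comp_app ψ (pullback.lift x e h) _ _ _).trans (app_congr rfl ?_ ?_ _ _)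
    · exact (Category.assoc _ _ _).symm.trans
        (congrArg (· ≫ φ.onPos) (pullback.lift_fst _ _ _))
    · exact pullback.lift_snd _ _ _

theorem id_comp (φ : ArrowLens p q) : (ArrowLens.id p).comp φ = φ := by
  refine ArrowLens.ext (by simp) fun x e h h' => ?_
  rw [ArrowLens.comp_app', ArrowLens.id_app]
  exact ArrowLens.app_congr rfl (by simp) rfl _ _

theorem comp_id (φ : ArrowLens p q) : φ.comp (ArrowLens.id q) = φ := by
  refine ArrowLens.ext (by simp) fun x e h h' => ?_
  rw [ArrowLens.comp_app']
  exact ArrowLens.app_congr rfl rfl (by simp) _ _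

theorem assoc {X Y : E} {t : X ⟶ Y} (φ : ArrowLens p q) (ψ : ArrowLens q r)
    (χ : ArrowLens r t) : (φ.comp ψ).comp χ = φ.comp (ψ.comp χ) := by
  refine ArrowLens.ext (by simp) fun x e h h' => ?_
  simp only [ArrowLens.comp_app']
  refine ArrowLens.app_congr rfl rfl ?_ _ _
  refine ArrowLens.app_congr rfl rfl ?_ _ _
  exact ArrowLens.app_congr rfl (by simp) rfl _ _

/-- A morphism is cartesian when its component on directions is invertible. -/
def IsCartesian (φ : ArrowLens p q) : Prop := IsIso φ.onDir

end ArrowLens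

variable (E) in
/-- A polynomial in `E` is an exponentiable morphism `dir ⟶ pos`. -/
structure Poly where
  pos : E
  dir : E
  map : dir ⟶ pos
  exponentiable : Exponentiable map

noncomputable instance : Category (Poly E) where
  Hom p q := ArrowLens p.map q.map
  id p := ArrowLens.id p.map
  comp φ ψ := φ.comp ψ
  id_comp φ := φ.id_comp
  comp_id φ := φ.comp_id
  assoc φ ψ χ := φ.assoc ψ χ

namespace Poly

/-- The action of a morphism of polynomials on directions, on generalized elements. -/
noncomputable abbrev onDirApp {p q : Poly E} (φ : p ⟶ q) {T : E} (x : T ⟶ p.pos) (e : T ⟶ q.dir)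
    (h : x ≫ ArrowLens.onPos φ = e ≫ q.map) : T ⟶ p.dir := ArrowLens.app φ x e h

@[simp] theorem id_onPos (p : Poly E) : ArrowLens.onPos (𝟙 p) = 𝟙 p.pos := rfl

@[simp] theorem comp_onPos {p q r : Poly E} (φ : p ⟶ q) (ψ : q ⟶ r) :
    ArrowLens.onPos (φ ≫ ψ) = ArrowLens.onPos φ ≫ ArrowLens.onPos ψ := rfl

/-- The functor `Π_p`, right adjoint to pullback along `p`. -/
noncomputable def Pi (p : Poly E) : Over p.dir ⥤ Over p.pos :=
  haveI : (Over.pullback p.map).IsLeftAdjoint := p.exponentiable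
  Functor.rightAdjoint (Over.pullback p.map)

/-- The adjunction `Δ_p ⊣ Π_p`. -/
noncomputable def piAdj (p : Poly E) : Over.pullback p.map ⊣ p.Pi :=
  haveI : (Over.pullback p.map).IsLeftAdjoint := p.exponentiable
  Adjunction.ofIsLeftAdjoint (Over.pullback p.map)

/-- The polynomial endofunctor of `p`: the composite of `- × p.dir : E ⥤ E/p.dir`, of
`Π_p : E/p.dir ⥤ E/p.pos` and of the forgetful functor `E/p.pos ⥤ E`. -/
noncomputable def functor (p : Poly E) : E ⥤ E :=
  Over.star p.dir ⋙ p.Pi ⋙ Over.forget p.pos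

/-- The projection `P(p)(A) ⟶ p.pos`. -/
noncomputable def proj (p : Poly E) (A : E) : p.functor.obj A ⟶ p.pos :=
  (p.Pi.obj ((Over.star p.dir).obj A)).hom

/-- The adjunction defining `P(p)(A)`. -/
noncomputable def starPiAdj (p : Poly E) :
    Over.pullback p.map ⋙ Over.forget p.dir ⊣ Over.star p.dir ⋙ p.Pi :=
  p.piAdj.comp (Over.forgetAdjStar p.dir)

/-- The universal evaluation `P(p)(A) ×_{p.pos} p.dir ⟶ A`. -/
noncomputable def ev (p : Poly E) (A : E) : pullback (p.proj A) p.map ⟶ A :=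
  p.starPiAdj.counit.app A

/-- Evaluate an element `u` of `P(p)(A)` at a direction `e` of its position. -/
noncomputable def eval (p : Poly E) {A T : E} (u : T ⟶ p.functor.obj A) (e : T ⟶ p.dir)
    (h : u ≫ p.proj A = e ≫ p.map) : T ⟶ A :=
  pullback.lift u e h ≫ p.ev A

/-- The universal property of `P(p)(A)`: a morphism `T ⟶ P(p)(A)` amounts to a morphism
`x : T ⟶ p.pos` and a morphism `T ×_{p.pos} p.dir ⟶ A`. -/
noncomputable def curry (p : Poly E) {A T : E} (x : T ⟶ p.pos) (g : pullback x p.map ⟶ A) :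
    T ⟶ p.functor.obj A :=
  (p.starPiAdj.homEquiv (Over.mk x) A g).left

@[simp]
theorem curry_proj (p : Poly E) {A T : E} (x : T ⟶ p.pos) (g : pullback x p.map ⟶ A) :
    p.curry x g ≫ p.proj A = x :=
  Over.w (p.starPiAdj.homEquiv (Over.mk x) A g)

@[simp]
theorem curry_proj_assoc (p : Poly E) {A T : E} (x : T ⟶ p.pos) (g : pullback x p.map ⟶ A)
    {Z : E} (k : p.pos ⟶ Z) : p.curry x g ≫ p.proj A ≫ k = x ≫ k := by
  rw [← Category.assoc, curry_proj]

theorem comp_eval (p : Poly E) {A S T : E} (s : S ⟶ T) (u : T ⟶ p.functor.obj A) (e : T ⟶ p.dir)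
    (h : u ≫ p.proj A = e ≫ p.map) :
    s ≫ p.eval u e h = p.eval (s ≫ u) (s ≫ e) (by simp [h]) := by
  rw [eval, eval, ← Category.assoc]
  congr 1
  apply pullback.hom_ext <;> simp

theorem eval_congr (p : Poly E) {A T : E} {u u' : T ⟶ p.functor.obj A} {e e' : T ⟶ p.dir}
    (hu : u = u') (he : e = e') (h : u ≫ p.proj A = e ≫ p.map) (h' : u' ≫ p.proj A = e' ≫ p.map) :
    p.eval u e h = p.eval u' e' h' := by
  subst hu he; rfl

theorem counit_eq (p : Poly E) {A : E} {T : Over p.pos}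
    (w : T ⟶ (Over.star p.dir ⋙ p.Pi).obj A) :
    (p.starPiAdj.homEquiv T A).symm w =
      pullback.lift (pullback.fst T.hom p.map ≫ w.left) (pullback.snd T.hom p.map)
        ((Category.assoc _ _ _).trans ((congrArg (pullback.fst T.hom p.map ≫ ·) (Over.w w)).trans
          pullback.condition)) ≫ p.ev A := by
  rw [Adjunction.homEquiv_counit]
  rfl

theorem eval_comp_curry (p : Poly E) {A S T : E} (s : S ⟶ T) (x : T ⟶ p.pos)
    (g : pullback x p.map ⟶ A) (e : S ⟶ p.dir) (h : (s ≫ p.curry x g) ≫ p.proj A = e ≫ p.map) :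
    p.eval (s ≫ p.curry x g) e h = pullback.lift s e (by rw [← h]; simp) ≫ g := by
  have : g = pullback.lift (pullback.fst x p.map ≫ p.curry x g) (pullback.snd x p.map)
      (by rw [Category.assoc, curry_proj, pullback.condition]) ≫ p.ev A :=
    ((p.starPiAdj.homEquiv (Over.mk x) A).symm_apply_apply g).symm.trans
      (p.counit_eq (p.starPiAdj.homEquiv (Over.mk x) A g))
  refine Eq.trans ?_ (congrArg (pullback.lift s e (by rw [← h]; simp) ≫ ·) this.symm)
  rw [eval, ← Category.assoc]
  congr 1
  apply pullback.hom_ext <;> simp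

theorem eval_curry (p : Poly E) {A T : E} (x : T ⟶ p.pos) (g : pullback x p.map ⟶ A)
    (e : T ⟶ p.dir) (h : p.curry x g ≫ p.proj A = e ≫ p.map) :
    p.eval (p.curry x g) e h = pullback.lift (𝟙 T) e (by rw [← h]; simp) ≫ g := by
  rw [← eval_comp_curry p (𝟙 T) x g e (by simpa using h)]
  exact eval_congr p (by simp) rfl _ _

theorem hom_ext (p : Poly E) {A T : E} {u v : T ⟶ p.functor.obj A}
    (h : u ≫ p.proj A = v ≫ p.proj A)
    (h' : ∀ {S : E} (s : S ⟶ T) (e : S ⟶ p.dir) (hu : (s ≫ u) ≫ p.proj A = e ≫ p.map)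
      (hv : (s ≫ v) ≫ p.proj A = e ≫ p.map), p.eval (s ≫ u) e hu = p.eval (s ≫ v) e hv) :
    u = v := by
  let U : Over.mk (u ≫ p.proj A) ⟶ (Over.star p.dir ⋙ p.Pi).obj A := Over.homMk u rfl
  let V : Over.mk (u ≫ p.proj A) ⟶ (Over.star p.dir ⋙ p.Pi).obj A := Over.homMk v h.symm
  suffices U = V from congrArg CommaMorphism.left this
  apply (p.starPiAdj.homEquiv _ A).symm.injective
  rw [counit_eq, counit_eq]
  exact h' (pullback.fst (u ≫ p.proj A) p.map) (pullback.snd (u ≫ p.proj A) p.map)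
    (by rw [Category.assoc, pullback.condition])
    (by rw [Category.assoc, ← h, pullback.condition])

@[simp]
theorem map_proj (p : Poly E) {A A' : E} (f : A ⟶ A') :
    p.functor.map f ≫ p.proj A' = p.proj A :=
  Over.w (p.Pi.map ((Over.star p.dir).map f))

@[simp]
theorem map_proj_assoc (p : Poly E) {A A' : E} (f : A ⟶ A') {Z : E} (k : p.pos ⟶ Z) :
    p.functor.map f ≫ p.proj A' ≫ k = p.proj A ≫ k := by
  rw [← Category.assoc, map_proj]

theorem map_ev (p : Poly E) {A A' : E} (f : A ⟶ A') :
    pullback.lift (pullback.fst (p.proj A) p.map ≫ p.functor.map f)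
      (pullback.snd (p.proj A) p.map) (by rw [Category.assoc, map_proj, pullback.condition]) ≫
      p.ev A' = p.ev A ≫ f :=
  p.starPiAdj.counit.naturality f

theorem eval_map (p : Poly E) {A A' T : E} (f : A ⟶ A') (u : T ⟶ p.functor.obj A) (e : T ⟶ p.dir)
    (h : (u ≫ p.functor.map f) ≫ p.proj A' = e ≫ p.map) :
    p.eval (u ≫ p.functor.map f) e h = p.eval u e (by simpa using h) ≫ f := by
  rw [eval, eval, Category.assoc, ← map_ev, ← Category.assoc]
  congr 1
  apply pullback.hom_ext <;> simp

/-- The natural transformation `P(p) ⟶ P(q)` of a morphism of polynomials `φ : p ⟶ q`, given on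
generalized elements by `(x, g) ↦ (φ x, g ∘ φ♯)`. -/
noncomputable def natApp {p q : Poly E} (φ : p ⟶ q) (A : E) : p.functor.obj A ⟶ q.functor.obj A :=
  q.curry (p.proj A ≫ ArrowLens.onPos φ)
    (p.eval (pullback.fst (p.proj A ≫ ArrowLens.onPos φ) q.map)
      (ArrowLens.app φ (pullback.fst (p.proj A ≫ ArrowLens.onPos φ) q.map ≫ p.proj A)
        (pullback.snd (p.proj A ≫ ArrowLens.onPos φ) q.map)
        (by rw [Category.assoc, pullback.condition]))
      (by rw [ArrowLens.app_comp]))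

@[simp]
theorem natApp_proj {p q : Poly E} (φ : p ⟶ q) (A : E) :
    natApp φ A ≫ q.proj A = p.proj A ≫ ArrowLens.onPos φ := by
  simp [natApp]

@[simp]
theorem natApp_proj_assoc {p q : Poly E} (φ : p ⟶ q) (A : E) {Z : E} (k : q.pos ⟶ Z) :
    natApp φ A ≫ q.proj A ≫ k = p.proj A ≫ ArrowLens.onPos φ ≫ k := by
  rw [← Category.assoc, natApp_proj, Category.assoc]

theorem eval_natApp {p q : Poly E} (φ : p ⟶ q) {A T : E} (u : T ⟶ p.functor.obj A)
    (e : T ⟶ q.dir) (h : (u ≫ natApp φ A) ≫ q.proj A = e ≫ q.map) :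
    q.eval (u ≫ natApp φ A) e h =
      p.eval u (ArrowLens.app φ (u ≫ p.proj A) e (by rw [← h]; simp))
        (by rw [ArrowLens.app_comp]) := by
  refine (q.eval_comp_curry _ _ _ _ _).trans ?_
  rw [comp_eval]
  refine eval_congr p (by simp) ?_ _ _
  rw [ArrowLens.comp_app]
  exact ArrowLens.app_congr rfl (by simp) (by simp) _ _

/-- The natural transformation induced by a morphism of polynomials. -/
@[simps]
noncomputable def natTrans {p q : Poly E} (φ : p ⟶ q) : p.functor ⟶ q.functor where
  app A := natApp φ A
  naturality A A' f := by
    refine q.hom_ext (by simp) fun s e hu hv => ?_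
    have hu' := hu
    have hv' := hv
    rw [← Category.assoc] at hu' hv'
    refine (q.eval_congr (Category.assoc _ _ _).symm rfl _ hu').trans ?_
    refine Eq.trans ?_ (q.eval_congr (Category.assoc _ _ _).symm rfl _ hv').symm
    rw [eval_natApp, eval_map, eval_map, eval_natApp]
    congr 1
    refine p.eval_congr rfl ?_ _ _
    exact ArrowLens.app_congr rfl (by simp) rfl _ _

variable (E) in
/-- The functor from polynomials to endofunctors of `E`. -/
@[simps]
noncomputable def toEndofunctor : Poly E ⥤ (E ⥤ E) where
  obj p := p.functor
  map φ := natTrans φ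
  map_id p := by
    ext A
    refine p.hom_ext (by simp) fun s e hu hv => ?_
    simp only [natTrans_app] at hu hv ⊢
    rw [eval_natApp]
    exact p.eval_congr (by simp) (ArrowLens.id_app _ _ _) _ _
  map_comp {p q r} φ ψ := by
    ext A
    refine r.hom_ext (by simp) fun s e hu hv => ?_
    simp only [natTrans_app, NatTrans.comp_app] at hu hv ⊢
    have hv' := hv
    rw [← Category.assoc s] at hv'
    refine Eq.trans ?_ (r.eval_congr (Category.assoc _ _ _).symm rfl _ hv').symm
    rw [eval_natApp, eval_natApp, eval_natApp]
    refine p.eval_congr rfl ?_ _ _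
    refine (ArrowLens.comp_app' φ ψ _ _ _).trans ?_
    refine ArrowLens.app_congr rfl rfl ?_ _ _
    exact ArrowLens.app_congr rfl (by simp) rfl _ _

instance : (toEndofunctor E).Faithful where
  map_injective {p q} φ ψ h := by
    let gen : p.pos ⟶ p.functor.obj p.dir := p.curry (𝟙 _) (pullback.snd (𝟙 _) p.map)
    have hgen : gen ≫ p.proj _ = 𝟙 _ := curry_proj _ _ _
    have key : gen ≫ natApp φ p.dir = gen ≫ natApp ψ p.dir :=
      congrArg (gen ≫ NatTrans.app · p.dir) h
    have pos : ∀ χ : p ⟶ q, (gen ≫ natApp χ p.dir) ≫ q.proj p.dir = ArrowLens.onPos χ := by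
      intro χ
      rw [Category.assoc, natApp_proj, reassoc_of% hgen]
    have dir : ∀ (χ : p ⟶ q) {T : E} (x : T ⟶ p.pos) (e : T ⟶ q.dir)
        (h : x ≫ ArrowLens.onPos χ = e ≫ q.map)
        (h' : (x ≫ gen ≫ natApp χ p.dir) ≫ q.proj p.dir = e ≫ q.map),
        ArrowLens.app χ x e h = q.eval (x ≫ gen ≫ natApp χ p.dir) e h' := by
      intro χ T x e h h'
      have h'' := h'
      rw [← Category.assoc x] at h''
      refine Eq.trans ?_ (q.eval_congr (Category.assoc _ _ _).symm rfl _ h'').symm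
      rw [eval_natApp]
      refine Eq.trans ?_ (p.eval_comp_curry x _ _ _ _).symm
      rw [pullback.lift_snd]
      exact ArrowLens.app_congr rfl (by rw [Category.assoc, hgen, Category.comp_id]) rfl _ _
    refine ArrowLens.ext (by rw [← pos φ, ← pos ψ, key]) fun x e h h' => ?_
    rw [dir φ x e h (by rw [Category.assoc, pos, h]), dir ψ x e h' (by rw [Category.assoc, pos, h'])]
    exact q.eval_congr (by rw [key]) rfl _ _

variable (E) in
/-- The identity polynomial `y`, the identity of the terminal object. -/
noncomputable abbrev y : Poly E := ⟨⊤_ E, ⊤_ E, 𝟙 _, Exponentiable.id _⟩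

/-- The directions `(P(p)(q.pos) ×_{p.pos} p.dir) ×_{q.pos} q.dir` of the composition product. -/
noncomputable def triDir (p q : Poly E) : E := pullback (p.ev q.pos) q.map

/-- The underlying morphism of the composition product: the composite of the top row of
```
triDir ---> P(p)(q.pos) ×_{p.pos} p.dir ------> P(p)(q.pos)
 |                  |            |                   |
 |               ev |            |                   |
 v                  v            v                   v
q.dir -----------> q.pos       p.dir ------------> p.pos
```
in which both squares are pullbacks and the right-hand one, together with `ev`, is the
distributivity pullback. -/
noncomputable def triMap (p q : Poly E) : triDir p q ⟶ p.functor.obj q.pos :=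
  pullback.fst (p.ev q.pos) q.map ≫ pullback.fst (p.proj q.pos) p.map

theorem triMap_exponentiable (p q : Poly E) : Exponentiable (triMap p q) :=
  (q.exponentiable.of_isPullback (IsPullback.of_hasPullback _ _).flip).comp
    (p.exponentiable.of_isPullback (IsPullback.of_hasPullback _ _).flip)

/-- The composition product `p ◁ q` of polynomials. -/
noncomputable abbrev tri (p q : Poly E) : Poly E :=
  ⟨p.functor.obj q.pos, triDir p q, triMap p q, triMap_exponentiable p q⟩

/-- A direction of `p ◁ q` at `u` is a direction `a` of `p` at the position of `u` together with a
direction `b` of `q` at the value of `u` at `a`. -/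
noncomputable def triMk (p q : Poly E) {T : E} (u : T ⟶ p.functor.obj q.pos) (a : T ⟶ p.dir)
    (b : T ⟶ q.dir) (h : u ≫ p.proj q.pos = a ≫ p.map) (h' : p.eval u a h = b ≫ q.map) :
    T ⟶ triDir p q :=
  pullback.lift (pullback.lift u a h) b h'

/-- The component of a direction of `p ◁ q` in `p`. -/
noncomputable def triFst (p q : Poly E) : triDir p q ⟶ p.dir :=
  pullback.fst (p.ev q.pos) q.map ≫ pullback.snd (p.proj q.pos) p.map

/-- The component of a direction of `p ◁ q` in `q`. -/
noncomputable def triSnd (p q : Poly E) : triDir p q ⟶ q.dir :=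
  pullback.snd (p.ev q.pos) q.map

section

variable (p q : Poly E) {T : E} (u : T ⟶ p.functor.obj q.pos) (a : T ⟶ p.dir)
    (b : T ⟶ q.dir) (h : u ≫ p.proj q.pos = a ≫ p.map) (h' : p.eval u a h = b ≫ q.map)

@[simp]
theorem triMk_map : triMk p q u a b h h' ≫ triMap p q = u :=
  (pullback.lift_fst_assoc _ _ _ _).trans (pullback.lift_fst _ _ _)

@[simp]
theorem triMk_map_assoc {Z : E} (k : p.functor.obj q.pos ⟶ Z) :
    triMk p q u a b h h' ≫ triMap p q ≫ k = u ≫ k := by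
  rw [← Category.assoc, triMk_map]

@[simp]
theorem triMk_fst : triMk p q u a b h h' ≫ triFst p q = a :=
  (pullback.lift_fst_assoc _ _ _ _).trans (pullback.lift_snd _ _ _)

@[simp]
theorem triMk_fst_assoc {Z : E} (k : p.dir ⟶ Z) :
    triMk p q u a b h h' ≫ triFst p q ≫ k = a ≫ k := by
  rw [← Category.assoc, triMk_fst]

@[simp]
theorem triMk_snd : triMk p q u a b h h' ≫ triSnd p q = b :=
  pullback.lift_snd _ _ _

@[simp]
theorem triMk_snd_assoc {Z : E} (k : q.dir ⟶ Z) :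
    triMk p q u a b h h' ≫ triSnd p q ≫ k = b ≫ k := by
  rw [← Category.assoc, triMk_snd]

theorem triFst_map : triFst p q ≫ p.map = triMap p q ≫ p.proj q.pos := by
  refine (Category.assoc _ _ _).trans (Eq.trans ?_ (Category.assoc _ _ _).symm)
  rw [pullback.condition]

theorem triSnd_map' :
    triSnd p q ≫ q.map = pullback.fst (p.ev q.pos) q.map ≫ p.ev q.pos :=
  pullback.condition.symm

theorem triSnd_map {d : T ⟶ triDir p q} {u : T ⟶ p.functor.obj q.pos} {a : T ⟶ p.dir}
    (hu : u = d ≫ triMap p q) (ha : a = d ≫ triFst p q) (h : u ≫ p.proj q.pos = a ≫ p.map) :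
    p.eval u a h = (d ≫ triSnd p q) ≫ q.map := by
  subst hu ha
  rw [Category.assoc, triSnd_map']
  refine Eq.trans ?_ (Category.assoc _ _ _)
  refine congrArg (· ≫ p.ev q.pos) ?_
  apply pullback.hom_ext
  · exact (pullback.lift_fst _ _ _).trans (Category.assoc _ _ _).symm
  · exact (pullback.lift_snd _ _ _).trans (Category.assoc _ _ _).symm

variable {p q} in
theorem tri_hom_ext {s t : T ⟶ triDir p q} (h0 : s ≫ triMap p q = t ≫ triMap p q)
    (h1 : s ≫ triFst p q = t ≫ triFst p q) (h2 : s ≫ triSnd p q = t ≫ triSnd p q) : s = t := by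
  apply pullback.hom_ext
  · apply pullback.hom_ext
    · exact (Category.assoc _ _ _).trans (h0.trans (Category.assoc _ _ _).symm)
    · exact (Category.assoc _ _ _).trans (h1.trans (Category.assoc _ _ _).symm)
  · exact h2

variable {p q u a b} in
theorem triMk_congr {u' : T ⟶ p.functor.obj q.pos} {a' : T ⟶ p.dir} {b' : T ⟶ q.dir}
    (hu : u = u') (ha : a = a') (hb : b = b') (h₁ : u' ≫ p.proj q.pos = a' ≫ p.map)
    (h₂ : p.eval u' a' h₁ = b' ≫ q.map) : triMk p q u a b h h' = triMk p q u' a' b' h₁ h₂ := by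
  subst hu ha hb; rfl

theorem comp_triMk {S : E} (s : S ⟶ T) : s ≫ triMk p q u a b h h' =
    triMk p q (s ≫ u) (s ≫ a) (s ≫ b) (by simp [h]) (by rw [← comp_eval _ _ _ _ h, h',
      Category.assoc]) := by
  apply tri_hom_ext <;> simp

end

/-- For `u` in `P(p ◁ q)(A)` and a direction `a` of `p` at its position, the value in `q.pos`. -/
noncomputable def alphaPos (p q : Poly E) (A : E) :
    pullback ((tri p q).proj A ≫ p.proj q.pos) p.map ⟶ q.pos :=
  p.eval (pullback.fst ((tri p q).proj A ≫ p.proj q.pos) p.map ≫ (tri p q).proj A)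
    (pullback.snd ((tri p q).proj A ≫ p.proj q.pos) p.map)
    (by rw [Category.assoc, pullback.condition])

/-- For `u` in `P(p ◁ q)(A)`, a direction `a` of `p` at its position, and a direction `b` of `q` at
the value of `u` at `a`, the direction `(a, b)` of `p ◁ q`. -/
noncomputable def alphaDir (p q : Poly E) (A : E) :
    pullback (alphaPos p q A) q.map ⟶ triDir p q :=
  triMk p q
    (pullback.fst (alphaPos p q A) q.map ≫
      pullback.fst ((tri p q).proj A ≫ p.proj q.pos) p.map ≫ (tri p q).proj A)
    (pullback.fst (alphaPos p q A) q.map ≫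
      pullback.snd ((tri p q).proj A ≫ p.proj q.pos) p.map)
    (pullback.snd (alphaPos p q A) q.map)
    (by simp only [Category.assoc, pullback.condition])
    ((p.comp_eval _ _ _ _).symm.trans pullback.condition)

/-- For `u` in `P(p ◁ q)(A)` and a direction `a` of `p` at its position, the element
`b ↦ u (a, b)` of `P(q)(A)`. -/
noncomputable def alphaVal (p q : Poly E) (A : E) :
    pullback ((tri p q).proj A ≫ p.proj q.pos) p.map ⟶ q.functor.obj A :=
  q.curry (alphaPos p q A)
    ((tri p q).eval (pullback.fst (alphaPos p q A) q.map ≫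
        pullback.fst ((tri p q).proj A ≫ p.proj q.pos) p.map)
      (alphaDir p q A)
      (by rw [alphaDir, triMk_map, Category.assoc]))

/-- The comparison `P(p ◁ q)(A) ⟶ P(p)(P(q)(A))`, `u ↦ (a ↦ (b ↦ u (a, b)))`. -/
noncomputable def alpha (p q : Poly E) (A : E) :
    (tri p q).functor.obj A ⟶ p.functor.obj (q.functor.obj A) :=
  p.curry ((tri p q).proj A ≫ p.proj q.pos) (alphaVal p q A)

@[simp]
theorem alpha_proj (p q : Poly E) (A : E) :
    alpha p q A ≫ p.proj _ = (tri p q).proj A ≫ p.proj q.pos := by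
  simp [alpha]

@[simp]
theorem alpha_proj_assoc (p q : Poly E) (A : E) {Z : E} (k : p.pos ⟶ Z) :
    alpha p q A ≫ p.proj _ ≫ k = (tri p q).proj A ≫ p.proj q.pos ≫ k := by
  rw [← Category.assoc, alpha_proj, Category.assoc]

theorem eval_alpha_proj (p q : Poly E) {A T : E} (u : T ⟶ (tri p q).functor.obj A)
    (a : T ⟶ p.dir) (h : (u ≫ alpha p q A) ≫ p.proj _ = a ≫ p.map) :
    p.eval (u ≫ alpha p q A) a h ≫ q.proj A =
      p.eval (u ≫ (tri p q).proj A) a (by rw [← h]; simp) := by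
  refine (congrArg (· ≫ q.proj A) (p.eval_comp_curry _ _ _ _ _)).trans ?_
  refine (Category.assoc _ _ _).trans ((_ ≫= q.curry_proj _ _).trans ?_)
  refine (p.comp_eval _ _ _ _).trans ?_
  exact p.eval_congr (by simp) (by simp) _ _

theorem eval_eval_alpha (p q : Poly E) {A T S : E} (s : S ⟶ T) (u : T ⟶ (tri p q).functor.obj A)
    (a : T ⟶ p.dir) (b : S ⟶ q.dir) (h : (u ≫ alpha p q A) ≫ p.proj _ = a ≫ p.map)
    (h' : (s ≫ p.eval (u ≫ alpha p q A) a h) ≫ q.proj A = b ≫ q.map) :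
    q.eval (s ≫ p.eval (u ≫ alpha p q A) a h) b h' =
      (tri p q).eval (s ≫ u) (triMk p q (s ≫ u ≫ (tri p q).proj A) (s ≫ a) b
        (by have := s ≫= h; simpa using this)
        (((p.comp_eval s (u ≫ (tri p q).proj A) a (by rw [← h]; simp)).symm.trans
          (s ≫= (eval_alpha_proj p q u a h).symm)).trans ((Category.assoc _ _ _).symm.trans h')))
        (by rw [triMk_map]; simp) := by
  have e1 : p.eval (u ≫ alpha p q A) a h = _ := p.eval_comp_curry _ _ _ _ _
  have e2 : s ≫ p.eval (u ≫ alpha p q A) a h = _ := (s ≫= e1).trans (Category.assoc _ _ _).symm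
  have h'' := h'
  rw [e2] at h''
  refine (q.eval_congr e2 rfl _ h'').trans ?_
  refine (q.eval_comp_curry _ _ _ _ _).trans ?_
  rw [comp_eval]
  refine (tri p q).eval_congr (by simp) ?_ _ _
  refine (comp_triMk _ _ _ _ _ _ _ _).trans ?_
  exact triMk_congr _ _ (by simp) (by simp) (by simp) _ _

/-- The inverse comparison `P(p)(P(q)(A)) ⟶ P(p ◁ q)(A)`. -/
noncomputable def alphaInv (p q : Poly E) (A : E) :
    p.functor.obj (q.functor.obj A) ⟶ (tri p q).functor.obj A :=
  (tri p q).curry (p.functor.map (q.proj A))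
    (q.eval (p.eval (pullback.fst (p.functor.map (q.proj A)) (triMap p q))
        (pullback.snd (p.functor.map (q.proj A)) (triMap p q) ≫ triFst p q)
        (by rw [Category.assoc, triFst_map, ← pullback.condition_assoc, map_proj]))
      (pullback.snd (p.functor.map (q.proj A)) (triMap p q) ≫ triSnd p q)
      (by
        rw [← triSnd_map p q (pullback.condition) rfl
          (by rw [Category.assoc, Category.assoc, triFst_map, ← pullback.condition_assoc]),
          ← eval_map]))

@[simp]
theorem alphaInv_proj (p q : Poly E) (A : E) :
    alphaInv p q A ≫ (tri p q).proj A = p.functor.map (q.proj A) := by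
  simp [alphaInv]

@[simp]
theorem alphaInv_proj_assoc (p q : Poly E) (A : E) {Z : E} (k : p.functor.obj q.pos ⟶ Z) :
    alphaInv p q A ≫ (tri p q).proj A ≫ k = p.functor.map (q.proj A) ≫ k := by
  rw [← Category.assoc, alphaInv_proj]

theorem eval_alphaInv_cond (p q : Poly E) {A T : E} (w : T ⟶ p.functor.obj (q.functor.obj A))
    (d : T ⟶ triDir p q) (h : (w ≫ alphaInv p q A) ≫ (tri p q).proj A = d ≫ triMap p q) :
    ∃ (h₁ : w ≫ p.proj _ = (d ≫ triFst p q) ≫ p.map),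
      p.eval w (d ≫ triFst p q) h₁ ≫ q.proj A = (d ≫ triSnd p q) ≫ q.map := by
  rw [Category.assoc, alphaInv_proj] at h
  have h₁ : w ≫ p.proj _ = (d ≫ triFst p q) ≫ p.map := by
    rw [Category.assoc, triFst_map, ← reassoc_of% h, map_proj]
  refine ⟨h₁, ?_⟩
  rw [← eval_map _ _ _ _ (by rw [Category.assoc, map_proj, h₁])]
  exact triSnd_map p q h rfl _

theorem eval_alphaInv (p q : Poly E) {A T : E} (w : T ⟶ p.functor.obj (q.functor.obj A))
    (d : T ⟶ triDir p q) (h : (w ≫ alphaInv p q A) ≫ (tri p q).proj A = d ≫ triMap p q) :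
    (tri p q).eval (w ≫ alphaInv p q A) d h =
      q.eval (p.eval w (d ≫ triFst p q) (eval_alphaInv_cond p q w d h).fst) (d ≫ triSnd p q)
        (eval_alphaInv_cond p q w d h).snd := by
  refine ((tri p q).eval_comp_curry _ _ _ _ _).trans ?_
  rw [comp_eval]
  refine q.eval_congr ?_ (by simp) _ _
  rw [comp_eval]
  exact p.eval_congr (by simp) (by simp) _ _

theorem alpha_alphaInv (p q : Poly E) (A : E) : alpha p q A ≫ alphaInv p q A = 𝟙 _ := by
  refine (tri p q).hom_ext ?_ fun s d hu hv => ?_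
  · rw [Category.assoc, alphaInv_proj, Category.id_comp]
    refine p.hom_ext (by simp) fun s e hu hv => ?_
    have hu' := hu
    rw [← Category.assoc s] at hu'
    refine (p.eval_congr (Category.assoc _ _ _).symm rfl _ hu').trans ?_
    rw [eval_map, eval_alpha_proj]
  · have hu' := hu
    rw [← Category.assoc s] at hu'
    refine ((tri p q).eval_congr (Category.assoc _ _ _).symm rfl _ hu').trans ?_
    obtain ⟨h₁, h₂⟩ := eval_alphaInv_cond p q _ _ hu'
    rw [eval_alphaInv p q _ _ _]
    have h₂' := h₂
    rw [← Category.id_comp (p.eval _ _ _)] at h₂'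
    refine (q.eval_congr (Category.id_comp _).symm rfl _ h₂').trans ?_
    rw [eval_eval_alpha]
    refine (tri p q).eval_congr (by simp) ?_ _ _
    apply tri_hom_ext
    · rw [triMk_map, ← hv]; simp
    · simp
    · simp

theorem alphaInv_alpha (p q : Poly E) (A : E) : alphaInv p q A ≫ alpha p q A = 𝟙 _ := by
  refine p.hom_ext (by simp) fun s a hu hv => ?_
  have hu' := hu
  rw [← Category.assoc s] at hu'
  refine (p.eval_congr (Category.assoc _ _ _).symm rfl _ hu').trans ?_
  have hs : s ≫ p.proj _ = a ≫ p.map := by rw [← hv, Category.comp_id]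
  refine q.hom_ext ?_ fun t b hu₁ hv₁ => ?_
  · rw [eval_alpha_proj]
    refine (p.eval_congr (by simp) rfl _ (by simpa using hs)).trans
      ((eval_map p (q.proj A) s a (by simpa using hs)).trans ?_)
    congr 1
    exact p.eval_congr (by simp) rfl _ _
  · rw [eval_eval_alpha]
    refine ((tri p q).eval_congr (Category.assoc t s _).symm rfl _
      (by rw [triMk_map]; simp)).trans ?_
    refine (eval_alphaInv p q (t ≫ s) _ _).trans ?_
    · refine q.eval_congr ?_ (by simp) _ _
      refine Eq.trans ?_ (p.comp_eval _ _ _ _).symm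
      exact p.eval_congr (by simp) (by simp) _ _


/-- The comparison `P(p ◁ q) ≅ P(p) ∘ P(q)`. -/
@[simps!]
noncomputable def alphaIso (p q : Poly E) : q.functor ⋙ p.functor ≅ (tri p q).functor :=
  NatIso.ofComponents (fun A => ⟨alphaInv p q A, alpha p q A, alphaInv_alpha p q A,
    alpha_alphaInv p q A⟩) fun {A A'} f => by
      refine (tri p q).hom_ext (by simp [← Functor.map_comp]) fun s d hu hv => ?_
      have hu' := hu
      have hv' := hv
      rw [← Category.assoc s] at hu' hv'
      refine ((tri p q).eval_congr (Category.assoc _ _ _).symm rfl _ hu').trans ?_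
      refine Eq.trans ?_ ((tri p q).eval_congr (Category.assoc _ _ _).symm rfl _ hv').symm
      dsimp only
      rw [eval_map, eval_alphaInv, eval_alphaInv]
      have := p.eval_map (q.functor.map f) s (d ≫ triFst p q) (eval_alphaInv_cond p q _ d hu').fst
      have h2 := (eval_alphaInv_cond p q _ d hu').snd
      refine (q.eval_congr this rfl _ (this ▸ h2)).trans ?_
      rw [eval_map]

/-- The comparison `P(y)(A) ⟶ A`, evaluation at the only direction. -/
noncomputable def beta (A : E) : (y E).functor.obj A ⟶ A :=
  (y E).eval (𝟙 _) (terminal.from _) (Subsingleton.elim _ _)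

/-- The inverse comparison `A ⟶ P(y)(A)`. -/
noncomputable def betaInv (A : E) : A ⟶ (y E).functor.obj A :=
  (y E).curry (terminal.from A) (pullback.fst _ _)

theorem comp_beta {A T : E} (u : T ⟶ (y E).functor.obj A) (e : T ⟶ ⊤_ E)
    (h : u ≫ (y E).proj A = e ≫ (y E).map) : u ≫ beta A = (y E).eval u e h :=
  ((y E).comp_eval _ _ _ _).trans ((y E).eval_congr (Category.comp_id _)
    (Subsingleton.elim _ _) _ _)

theorem eval_betaInv {A T : E} (u : T ⟶ A) (e : T ⟶ ⊤_ E)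
    (h : (u ≫ betaInv A) ≫ (y E).proj A = e ≫ (y E).map) :
    (y E).eval (u ≫ betaInv A) e h = u :=
  ((y E).eval_comp_curry _ _ _ _ _).trans (pullback.lift_fst _ _ _)

theorem betaInv_beta (A : E) : betaInv A ≫ beta A = 𝟙 A := by
  rw [comp_beta _ (terminal.from A) (Subsingleton.elim _ _)]
  refine ((y E).eval_congr (Category.id_comp _).symm rfl _ (Subsingleton.elim _ _)).trans ?_
  exact eval_betaInv (𝟙 A) _ _

theorem beta_betaInv (A : E) : beta A ≫ betaInv A = 𝟙 ((y E).functor.obj A) := by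
  refine (y E).hom_ext (Subsingleton.elim _ _) fun s e hu hv => ?_
  refine ((y E).eval_congr (Category.assoc _ _ _).symm rfl _ (Subsingleton.elim _ _)).trans ?_
  rw [eval_betaInv, comp_beta s e (Subsingleton.elim _ _)]
  exact (y E).eval_congr (Category.comp_id _).symm rfl _ _

/-- The comparison `P(y) ≅ id`. -/
@[simps!]
noncomputable def betaIso : 𝟭 E ≅ (y E).functor :=
  NatIso.ofComponents (fun A => ⟨betaInv A, beta A, betaInv_beta A, beta_betaInv A⟩)
    fun {A A'} f => by
      refine (y E).hom_ext (Subsingleton.elim _ _) fun s e hu hv => ?_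
      refine ((y E).eval_congr (Category.assoc _ _ _).symm rfl _ (Subsingleton.elim _ _)).trans ?_
      refine Eq.trans ?_ ((y E).eval_congr (Category.assoc _ _ _).symm rfl _
        (Subsingleton.elim _ _)).symm
      dsimp only
      rw [eval_map, eval_betaInv, eval_betaInv]
      rfl

section Monoidal

variable {p p' q q' r : Poly E}

theorem eval_of_eq (p q : Poly E) {T : E} {v : T ⟶ (tri p q).pos} {d : T ⟶ (tri p q).dir}
    (h : v = d ≫ (tri p q).map) :
    ∃ h' : v ≫ p.proj q.pos = (d ≫ triFst p q) ≫ p.map,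
      p.eval v (d ≫ triFst p q) h' = (d ≫ triSnd p q) ≫ q.map :=
  ⟨by subst h; rw [Category.assoc, Category.assoc, triFst_map], triSnd_map p q h rfl _⟩

/-- Composition of a morphism `f` of polynomials with `q` on the right, given on directions by
`(v, (a, b)) ↦ (f♯ (v, a), b)`. -/
noncomputable def tensorRight (f : p ⟶ p') (q : Poly E) : tri p q ⟶ tri p' q :=
  have cond : ∀ {T : E} (v : T ⟶ (tri p q).pos) (d : T ⟶ (tri p' q).dir)
      (h : v ≫ natApp f q.pos = d ≫ (tri p' q).map),
      (v ≫ p.proj q.pos) ≫ ArrowLens.onPos f = (d ≫ triFst p' q) ≫ p'.map := fun v d h => by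
    rw [← (eval_of_eq p' q h).fst, Category.assoc, Category.assoc, natApp_proj]
  ArrowLens.ofElements (natApp f q.pos)
    (fun v d h => triMk p q v (onDirApp f (v ≫ p.proj q.pos) (d ≫ triFst p' q) (cond v d h))
      (d ≫ triSnd p' q) (by rw [ArrowLens.app_comp]) (by
        rw [← (eval_of_eq p' q h).snd, eval_natApp]))
    (fun _ _ _ => triMk_map p q _ _ _ _ _)

theorem tensorRight_app (f : p ⟶ p') (q : Poly E) {T : E} (v : T ⟶ (tri p q).pos)
    (d : T ⟶ (tri p' q).dir) (h : v ≫ ArrowLens.onPos (tensorRight f q) = d ≫ (tri p' q).map)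
    (h₁ : (v ≫ p.proj q.pos) ≫ ArrowLens.onPos f = (d ≫ triFst p' q) ≫ p'.map)
    (h₂ : p.eval v (onDirApp f (v ≫ p.proj q.pos) (d ≫ triFst p' q) h₁)
      (by rw [ArrowLens.app_comp]) = (d ≫ triSnd p' q) ≫ q.map) :
    ArrowLens.app (tensorRight f q) v d h =
      triMk p q v (onDirApp f (v ≫ p.proj q.pos) (d ≫ triFst p' q) h₁) (d ≫ triSnd p' q)
        (by rw [ArrowLens.app_comp]) h₂ := by
  refine ArrowLens.ofElements_app _ _ (by intros; exact triMk_map p q _ _ _ _ _)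
    (fun s v d h => ?_)
    v d h
  rw [comp_triMk p q]
  refine triMk_congr (p := p) (q := q) _ _ rfl ?_ (Category.assoc _ _ _).symm _ _
  rw [ArrowLens.comp_app]
  exact ArrowLens.app_congr rfl (Category.assoc _ _ _).symm (Category.assoc _ _ _).symm _ _

/-- Composition of a morphism `g` of polynomials with `p` on the left, given on directions by
`(v, (a, b)) ↦ (a, g♯ (v a, b))`. -/
noncomputable def tensorLeft (p : Poly E) (g : q ⟶ q') : tri p q ⟶ tri p q' :=
  have cond₁ : ∀ {T : E} (v : T ⟶ (tri p q).pos) (d : T ⟶ (tri p q').dir)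
      (h : v ≫ p.functor.map (ArrowLens.onPos g) = d ≫ (tri p q').map),
      v ≫ p.proj q.pos = (d ≫ triFst p q') ≫ p.map := fun v d h => by
    rw [← (eval_of_eq p q' h).fst, Category.assoc, map_proj]
  have cond₂ : ∀ {T : E} (v : T ⟶ (tri p q).pos) (d : T ⟶ (tri p q').dir)
      (h : v ≫ p.functor.map (ArrowLens.onPos g) = d ≫ (tri p q').map),
      p.eval v (d ≫ triFst p q') (cond₁ v d h) ≫ ArrowLens.onPos g =
        (d ≫ triSnd p q') ≫ q'.map := fun v d h => by
    rw [← (eval_of_eq p q' h).snd, eval_map]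
  ArrowLens.ofElements (p.functor.map (ArrowLens.onPos g))
    (fun v d h => triMk p q v (d ≫ triFst p q')
      (onDirApp g (p.eval v (d ≫ triFst p q') (cond₁ v d h)) (d ≫ triSnd p q') (cond₂ v d h))
      (cond₁ v d h) (by rw [ArrowLens.app_comp]))
    (fun _ _ _ => triMk_map p q _ _ _ _ _)

theorem tensorLeft_app (p : Poly E) (g : q ⟶ q') {T : E} (v : T ⟶ (tri p q).pos)
    (d : T ⟶ (tri p q').dir) (h : v ≫ ArrowLens.onPos (tensorLeft p g) = d ≫ (tri p q').map)
    (h₁ : v ≫ p.proj q.pos = (d ≫ triFst p q') ≫ p.map)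
    (h₂ : p.eval v (d ≫ triFst p q') h₁ ≫ ArrowLens.onPos g = (d ≫ triSnd p q') ≫ q'.map) :
    ArrowLens.app (tensorLeft p g) v d h =
      triMk p q v (d ≫ triFst p q')
        (onDirApp g (p.eval v (d ≫ triFst p q') h₁) (d ≫ triSnd p q') h₂)
        h₁ (by rw [ArrowLens.app_comp]) := by
  refine ArrowLens.ofElements_app _ _ (by intros; exact triMk_map p q _ _ _ _ _)
    (fun s v d h => ?_)
    v d h
  rw [comp_triMk p q]
  refine triMk_congr (p := p) (q := q) _ _ rfl (Category.assoc _ _ _).symm ?_ _ _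
  rw [ArrowLens.comp_app]
  refine ArrowLens.app_congr rfl ?_ (Category.assoc _ _ _).symm _ _
  rw [comp_eval]
  exact p.eval_congr rfl (Category.assoc _ _ _).symm _ _

variable (p q r)

variable {p q r} in
theorem assocHom_cond {T : E} {u : T ⟶ (tri (tri p q) r).pos} {d : T ⟶ (tri p (tri q r)).dir}
    (h : u ≫ alpha p q r.pos = d ≫ (tri p (tri q r)).map) :
    ∃ (h₁ : (u ≫ (tri p q).proj r.pos) ≫ p.proj q.pos = (d ≫ triFst p (tri q r)) ≫ p.map)
      (h₂ : p.eval (u ≫ (tri p q).proj r.pos) (d ≫ triFst p (tri q r)) h₁ =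
        (d ≫ triSnd p (tri q r) ≫ triFst q r) ≫ q.map),
      (tri p q).eval u (triMk p q (u ≫ (tri p q).proj r.pos) (d ≫ triFst p (tri q r))
        (d ≫ triSnd p (tri q r) ≫ triFst q r) h₁ h₂) (triMk_map _ _ _ _ _ _ _).symm =
        (d ≫ triSnd p (tri q r) ≫ triSnd q r) ≫ r.map := by
  obtain ⟨h₁, h₂⟩ := eval_of_eq p (tri q r) h
  obtain ⟨h₃, h₄⟩ := eval_of_eq q r h₂
  have e₁ : (d ≫ triSnd p (tri q r)) ≫ triFst q r = d ≫ triSnd p (tri q r) ≫ triFst q r :=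
    Category.assoc _ _ _
  have e₂ : (d ≫ triSnd p (tri q r)) ≫ triSnd q r = d ≫ triSnd p (tri q r) ≫ triSnd q r :=
    Category.assoc _ _ _
  have c₁ : (u ≫ (tri p q).proj r.pos) ≫ p.proj q.pos = (d ≫ triFst p (tri q r)) ≫ p.map :=
    Eq.trans (by simp) h₁
  have c₂ : p.eval (u ≫ (tri p q).proj r.pos) (d ≫ triFst p (tri q r)) c₁ =
      (d ≫ triSnd p (tri q r) ≫ triFst q r) ≫ q.map :=
    (eval_alpha_proj p q u _ h₁).symm.trans (h₃.trans (congrArg (· ≫ q.map) e₁))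
  refine ⟨c₁, c₂, ?_⟩
  have h₅ : (𝟙 _ ≫ p.eval (u ≫ alpha p q r.pos) (d ≫ triFst p (tri q r)) h₁) ≫ q.proj r.pos =
      (d ≫ triSnd p (tri q r) ≫ triFst q r) ≫ q.map := by
    rw [Category.id_comp]; exact h₃.trans (congrArg (· ≫ q.map) e₁)
  refine Eq.trans ?_ ((eval_eval_alpha p q (𝟙 _) u _ _ h₁ h₅).symm.trans
    ((q.eval_congr (Category.id_comp _) e₁.symm _ h₃).trans (h₄.trans (congrArg (· ≫ r.map) e₂))))
  refine (tri p q).eval_congr (Category.id_comp _).symm ?_ _ _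
  exact triMk_congr (p := p) (q := q) _ _ (Category.id_comp _).symm (Category.id_comp _).symm
    rfl _ _

/-- The associator, given on directions by `(u, (a, (b, e))) ↦ ((a, b), e)`. -/
noncomputable def assocHom : tri (tri p q) r ⟶ tri p (tri q r) :=
  ArrowLens.ofElements (alpha p q r.pos)
    (fun u d h => triMk (tri p q) r u
      (triMk p q (u ≫ (tri p q).proj r.pos) (d ≫ triFst p (tri q r))
        (d ≫ triSnd p (tri q r) ≫ triFst q r) (assocHom_cond h).fst (assocHom_cond h).snd.fst)
      (d ≫ triSnd p (tri q r) ≫ triSnd q r)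
      (triMk_map p q _ _ _ _ _).symm
      (assocHom_cond h).snd.snd)
    (fun _ _ _ => triMk_map (tri p q) r _ _ _ _ _)

theorem assocHom_app {T : E} (u : T ⟶ (tri (tri p q) r).pos) (d : T ⟶ (tri p (tri q r)).dir)
    (h : u ≫ ArrowLens.onPos (assocHom p q r) = d ≫ (tri p (tri q r)).map) :
    ∃ h₁ h₂ h₃ h₄, ArrowLens.app (assocHom p q r) u d h = triMk (tri p q) r u
      (triMk p q (u ≫ (tri p q).proj r.pos) (d ≫ triFst p (tri q r))
        (d ≫ triSnd p (tri q r) ≫ triFst q r) h₁ h₂)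
      (d ≫ triSnd p (tri q r) ≫ triSnd q r) h₃ h₄ := by
  refine ⟨_, _, _, _, ArrowLens.ofElements_app _ _ (by intros; exact triMk_map (tri p q) r _ _ _ _ _)
    (fun s v d h => ?_)
    u d h⟩
  rw [comp_triMk (tri p q) r]
  refine triMk_congr (p := (tri p q)) (q := r) _ _ rfl ?_ (Category.assoc _ _ _).symm _ _
  rw [comp_triMk]
  exact triMk_congr _ _ (Category.assoc _ _ _).symm (Category.assoc _ _ _).symm
    (Category.assoc _ _ _).symm _ _

/-- The inverse of the associator, given on directions by `(w, ((a, b), e)) ↦ (a, (b, e))`. -/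
noncomputable def assocInv : tri p (tri q r) ⟶ tri (tri p q) r :=
  have c₀ : ∀ {T : E} (w : T ⟶ (tri p (tri q r)).pos) (d : T ⟶ (tri (tri p q) r).dir)
      (h : w ≫ alphaInv p q r.pos = d ≫ (tri (tri p q) r).map),
      ∃ (h₁ : w ≫ p.proj _ = (d ≫ triFst (tri p q) r ≫ triFst p q) ≫ p.map)
        (h₂ : p.eval w (d ≫ triFst (tri p q) r ≫ triFst p q) h₁ ≫ q.proj r.pos =
          (d ≫ triFst (tri p q) r ≫ triSnd p q) ≫ q.map),
        q.eval (p.eval w (d ≫ triFst (tri p q) r ≫ triFst p q) h₁)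
          (d ≫ triFst (tri p q) r ≫ triSnd p q) h₂ =
          (d ≫ triSnd (tri p q) r) ≫ r.map := fun w d h => by
    have h₁ := (eval_of_eq (tri p q) r h).fst
    have h₂ := (eval_of_eq (tri p q) r h).snd
    obtain ⟨h₃, h₄⟩ := eval_alphaInv_cond p q w _ h₁
    rw [eval_alphaInv] at h₂
    simp only [Category.assoc] at h₂ h₃ h₄ ⊢
    exact ⟨h₃, h₄, h₂⟩
  ArrowLens.ofElements (alphaInv p q r.pos)
    (fun w d h => triMk p (tri q r) w (d ≫ triFst (tri p q) r ≫ triFst p q)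
      (triMk q r (p.eval w (d ≫ triFst (tri p q) r ≫ triFst p q) (c₀ w d h).fst)
        (d ≫ triFst (tri p q) r ≫ triSnd p q) (d ≫ triSnd (tri p q) r) (c₀ w d h).snd.fst
        (c₀ w d h).snd.snd)
      (c₀ w d h).fst
      (triMk_map q r _ _ _ _ _).symm)
    (fun _ _ _ => triMk_map p (tri q r) _ _ _ _ _)

theorem assocInv_app {T : E} (w : T ⟶ (tri p (tri q r)).pos) (d : T ⟶ (tri (tri p q) r).dir)
    (h : w ≫ ArrowLens.onPos (assocInv p q r) = d ≫ (tri (tri p q) r).map) :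
    ∃ h₁ h₂ h₃ h₄, ArrowLens.app (assocInv p q r) w d h =
      triMk p (tri q r) w (d ≫ triFst (tri p q) r ≫ triFst p q)
      (triMk q r (p.eval w (d ≫ triFst (tri p q) r ≫ triFst p q) h₁)
        (d ≫ triFst (tri p q) r ≫ triSnd p q) (d ≫ triSnd (tri p q) r) h₂ h₃)
      h₁ h₄ := by
  refine ⟨_, _, _, _, ArrowLens.ofElements_app _ _ (by intros; exact triMk_map p (tri q r) _ _ _ _ _)
    (fun s v d h => ?_)
    w d h⟩
  rw [comp_triMk p (tri q r)]
  refine triMk_congr (p := p) (q := (tri q r)) _ _ rfl (Category.assoc _ _ _).symm ?_ _ _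
  rw [comp_triMk]
  refine triMk_congr _ _ ?_ (Category.assoc _ _ _).symm (Category.assoc _ _ _).symm _ _
  rw [comp_eval]
  exact p.eval_congr rfl (Category.assoc _ _ _).symm _ _

/-- The left unitor, given on directions by `(u, a) ↦ (*, a)`. -/
noncomputable def leftHom : tri (y E) p ⟶ p :=
  ArrowLens.ofElements (beta p.pos)
    (fun u a h => triMk (y E) p u (terminal.from _) a (Subsingleton.elim _ _)
      (by rw [← h, comp_beta]))
    (fun _ _ _ => triMk_map (y E) p _ _ _ _ _)

theorem leftHom_app {T : E} (u : T ⟶ (tri (y E) p).pos) (a : T ⟶ p.dir)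
    (h : u ≫ ArrowLens.onPos (leftHom p) = a ≫ p.map) :
    ∃ h₁, ArrowLens.app (leftHom p) u a h =
      triMk (y E) p u (terminal.from _) a (Subsingleton.elim _ _) h₁ := by
  refine ⟨_, ArrowLens.ofElements_app _ _ (by intros; exact triMk_map (y E) p _ _ _ _ _)
    (fun s v d h => ?_)
    u a h⟩
  rw [comp_triMk (y E) p]
  exact triMk_congr (p := (y E)) (q := p) _ _ rfl (Subsingleton.elim _ _) rfl _ _

/-- The inverse of the left unitor, given on directions by `(x, (*, a)) ↦ a`. -/
noncomputable def leftInv : p ⟶ tri (y E) p :=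
  ArrowLens.ofElements (betaInv p.pos) (fun _ d _ => d ≫ triSnd (y E) p)
    (fun x d h => by rw [← (eval_of_eq (y E) p h).snd, eval_betaInv])

theorem leftInv_app {T : E} (x : T ⟶ p.pos) (d : T ⟶ (tri (y E) p).dir)
    (h : x ≫ ArrowLens.onPos (leftInv p) = d ≫ (tri (y E) p).map) :
    ArrowLens.app (leftInv p) x d h = d ≫ triSnd (y E) p :=
  ArrowLens.ofElements_app _ _
    (fun x d h => by rw [← (eval_of_eq (y E) p h).snd, eval_betaInv])
    (fun s v d h => (Category.assoc _ _ _).symm) _ _ _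

/-- The right unitor, given on directions by `(u, a) ↦ (a, *)`. -/
noncomputable def rightHom : tri p (y E) ⟶ p :=
  ArrowLens.ofElements (p.proj (⊤_ E))
    (fun u a h => triMk p (y E) u a (terminal.from _) h (Subsingleton.elim _ _))
    (fun _ _ _ => triMk_map p (y E) _ _ _ _ _)

theorem rightHom_app {T : E} (u : T ⟶ (tri p (y E)).pos) (a : T ⟶ p.dir)
    (h : u ≫ ArrowLens.onPos (rightHom p) = a ≫ p.map) :
    ArrowLens.app (rightHom p) u a h =
      triMk p (y E) u a (terminal.from _) h (Subsingleton.elim _ _) := by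
  refine ArrowLens.ofElements_app _ _ (by intros; exact triMk_map p (y E) _ _ _ _ _)
    (fun s v d h => ?_)
    u a h
  refine (comp_triMk p (y E) _ _ _ _ _ _).trans ?_
  exact triMk_congr (p := p) (q := (y E)) _ _ rfl rfl (Subsingleton.elim _ _) _ _

/-- The inverse of the right unitor, given on directions by `(x, (a, *)) ↦ a`. -/
noncomputable def rightInv : p ⟶ tri p (y E) :=
  ArrowLens.ofElements (p.curry (𝟙 _) (terminal.from _)) (fun _ d _ => d ≫ triFst p (y E))
    (fun x d h => by
      rw [← (eval_of_eq p (y E) h).fst, Category.assoc, curry_proj, Category.comp_id])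

theorem rightInv_app {T : E} (x : T ⟶ p.pos) (d : T ⟶ (tri p (y E)).dir)
    (h : x ≫ ArrowLens.onPos (rightInv p) = d ≫ (tri p (y E)).map) :
    ArrowLens.app (rightInv p) x d h = d ≫ triFst p (y E) :=
  ArrowLens.ofElements_app _ _
    (fun x d h => by
      rw [← (eval_of_eq p (y E) h).fst, Category.assoc, curry_proj, Category.comp_id])
    (fun s v d h => (Category.assoc _ _ _).symm) _ _ _

variable {p q} in
theorem eval_alphaInv_triMk {A T : E} (w : T ⟶ p.functor.obj (q.functor.obj A))
    {v : T ⟶ p.functor.obj q.pos} {a : T ⟶ p.dir} {b : T ⟶ q.dir}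
    (h : v ≫ p.proj q.pos = a ≫ p.map) (h' : p.eval v a h = b ≫ q.map)
    (h'' : (w ≫ alphaInv p q A) ≫ (tri p q).proj A = triMk p q v a b h h' ≫ triMap p q)
    {u : T ⟶ q.functor.obj A}
    (k : w ≫ p.proj _ = a ≫ p.map) (hu : p.eval w a k = u) (k' : u ≫ q.proj A = b ≫ q.map) :
    (tri p q).eval (w ≫ alphaInv p q A) (triMk p q v a b h h') h'' = q.eval u b k' := by
  rw [eval_alphaInv]
  refine q.eval_congr (Eq.trans ?_ hu) (triMk_snd p q _ _ _ _ _) _ _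
  exact p.eval_congr rfl (triMk_fst p q _ _ _ _ _) _ _

variable {p q} in
theorem eval_alphaInv_proj {A T : E} (w : T ⟶ p.functor.obj (q.functor.obj A)) (a : T ⟶ p.dir)
    (h : w ≫ p.proj _ = a ≫ p.map)
    (h' : ((w ≫ alphaInv p q A) ≫ (tri p q).proj A) ≫ p.proj q.pos = a ≫ p.map) :
    p.eval ((w ≫ alphaInv p q A) ≫ (tri p q).proj A) a h' = p.eval w a h ≫ q.proj A := by
  rw [← p.eval_map (q.proj A) w _ (by simpa using h)]
  exact p.eval_congr (by simp) rfl _ _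

theorem natApp_tensorLeft {q q' : Poly E} (g : q ⟶ q') (A : E) :
    alphaInv p q A ≫ natApp (tensorLeft p g) A =
      p.functor.map (natApp g A) ≫ alphaInv p q' A := by
  refine (tri p q').hom_ext ?_ fun s d hu hv => ?_
  · rw [Category.assoc, Category.assoc, natApp_proj, alphaInv_proj, alphaInv_proj_assoc]
    exact ((p.functor.map_comp _ _).symm.trans
      (congrArg p.functor.map (natApp_proj g A).symm)).trans (p.functor.map_comp _ _)
  have hu' := hu
  have hv' := hv
  rw [← Category.assoc s] at hu' hv'
  refine ((tri p q').eval_congr (Category.assoc _ _ _).symm rfl _ hu').trans ?_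
  refine Eq.trans ?_ ((tri p q').eval_congr (Category.assoc _ _ _).symm rfl _ hv').symm
  obtain ⟨h₁, h₂⟩ := eval_alphaInv_cond p q' _ d hv'
  have h₁' : s ≫ p.proj _ = (d ≫ triFst p q') ≫ p.map := by rw [← h₁]; simp
  have e := p.eval_map (natApp g A) s (d ≫ triFst p q') h₁
  have h₂' := h₂
  rw [e] at h₂'
  rw [eval_alphaInv]
  refine Eq.trans ?_ (q'.eval_congr e rfl _ h₂').symm
  rw [eval_natApp, eval_natApp]
  have h₃ : ((s ≫ alphaInv p q A) ≫ (tri p q).proj A) ≫ p.proj q.pos =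
      (d ≫ triFst p q') ≫ p.map := by
    rw [← h₁', Category.assoc, Category.assoc, alphaInv_proj_assoc, map_proj]
  have e' := eval_alphaInv_proj s _ h₁' h₃
  have h₄ : p.eval ((s ≫ alphaInv p q A) ≫ (tri p q).proj A) (d ≫ triFst p q') h₃ ≫
      ArrowLens.onPos g = (d ≫ triSnd p q') ≫ q'.map := by
    rw [e', ← h₂', Category.assoc, Category.assoc, natApp_proj]
  refine ((tri p q).eval_congr rfl (tensorLeft_app p g _ d _ h₃ h₄) _
    (triMk_map p q _ _ _ _ _).symm).trans ?_
  rw [eval_alphaInv_triMk s _ _ _ h₁' rfl]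
  · exact q.eval_congr rfl (ArrowLens.app_congr rfl e' rfl _ _) _ _
  · rw [ArrowLens.app_comp, e']

theorem natApp_tensorRight {p p' : Poly E} (f : p ⟶ p') (q : Poly E) (A : E) :
    alphaInv p q A ≫ natApp (tensorRight f q) A =
      natApp f (q.functor.obj A) ≫ alphaInv p' q A := by
  refine (tri p' q).hom_ext ?_ fun s d hu hv => ?_
  · rw [Category.assoc, Category.assoc, natApp_proj, alphaInv_proj, alphaInv_proj_assoc]
    exact (natTrans f).naturality (q.proj A)
  have hu' := hu
  have hv' := hv
  rw [← Category.assoc s] at hu' hv'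
  refine ((tri p' q).eval_congr (Category.assoc _ _ _).symm rfl _ hu').trans ?_
  refine Eq.trans ?_ ((tri p' q).eval_congr (Category.assoc _ _ _).symm rfl _ hv').symm
  obtain ⟨h₁, h₂⟩ := eval_alphaInv_cond p' q _ d hv'
  have h₁' : (s ≫ p.proj _) ≫ ArrowLens.onPos f = (d ≫ triFst p' q) ≫ p'.map := by
    rw [← h₁]; simp
  have e := eval_natApp f s (d ≫ triFst p' q) h₁
  have h₂' := h₂
  rw [e] at h₂'
  rw [eval_alphaInv]
  refine Eq.trans ?_ (q.eval_congr e rfl _ h₂').symm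
  rw [eval_natApp]
  have h₃ : (((s ≫ alphaInv p q A) ≫ (tri p q).proj A) ≫ p.proj q.pos) ≫ ArrowLens.onPos f =
      (d ≫ triFst p' q) ≫ p'.map := by
    rw [← h₁']; simp
  have ea : ArrowLens.app f (((s ≫ alphaInv p q A) ≫ (tri p q).proj A) ≫ p.proj q.pos)
      (d ≫ triFst p' q) h₃ = ArrowLens.app f (s ≫ p.proj _) (d ≫ triFst p' q) h₁' :=
    ArrowLens.app_congr rfl (by simp) rfl _ _
  have k : s ≫ p.proj _ = ArrowLens.app f (((s ≫ alphaInv p q A) ≫ (tri p q).proj A) ≫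
      p.proj q.pos) (d ≫ triFst p' q) h₃ ≫ p.map := by rw [ea, ArrowLens.app_comp]
  have e' := eval_alphaInv_proj s _ k (by rw [ArrowLens.app_comp])
  have e'' : p.eval s _ k =
      p.eval s (onDirApp f (s ≫ p.proj _) (d ≫ triFst p' q) h₁') (by rw [ArrowLens.app_comp]) := p.eval_congr rfl ea _ _
  refine ((tri p q).eval_congr rfl (tensorRight_app f q _ d _ h₃ ?_) _
    (triMk_map p q _ _ _ _ _).symm).trans ?_
  · rw [e', e'']; exact h₂'
  exact eval_alphaInv_triMk s _ _ _ k e'' _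

theorem natApp_leftHom (A : E) :
    alphaInv (y E) p A ≫ natApp (leftHom p) A = beta (p.functor.obj A) := by
  refine p.hom_ext ?_ fun s d hu hv => ?_
  · rw [Category.assoc, natApp_proj, alphaInv_proj_assoc]
    exact (betaIso (E := E)).inv.naturality (p.proj A)
  have hu' := hu
  rw [← Category.assoc s] at hu'
  refine (p.eval_congr (Category.assoc _ _ _).symm rfl _ hu').trans ?_
  rw [eval_natApp]
  obtain ⟨h₁, h₂⟩ := leftHom_app p ((s ≫ alphaInv (y E) p A) ≫ (tri (y E) p).proj A) d
    (by rw [← hu']; simp)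
  refine ((tri (y E) p).eval_congr rfl h₂ _ (triMk_map (y E) p _ _ _ _ _).symm).trans ?_
  exact eval_alphaInv_triMk s _ _ _ (Subsingleton.elim _ _) (comp_beta _ _ _).symm _

theorem natApp_rightHom (A : E) :
    alphaInv p (y E) A ≫ natApp (rightHom p) A = p.functor.map (beta A) := by
  refine p.hom_ext ?_ fun s d hu hv => ?_
  · rw [Category.assoc, natApp_proj, alphaInv_proj_assoc]
    exact (map_proj _ _).trans (map_proj _ _).symm
  have hu' := hu
  rw [← Category.assoc s] at hu'
  refine (p.eval_congr (Category.assoc _ _ _).symm rfl _ hu').trans ?_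
  rw [eval_natApp, eval_map]
  refine ((tri p (y E)).eval_congr rfl (rightHom_app p _ d _) _
    (triMk_map p (y E) _ _ _ _ _).symm).trans ?_
  refine (eval_alphaInv_triMk s _ _ _ (by simpa using hv) rfl (Subsingleton.elim _ _)).trans ?_
  exact (comp_beta _ _ _).symm

theorem natApp_assocHom (A : E) :
    alphaInv p q (r.functor.obj A) ≫ alphaInv (tri p q) r A ≫ natApp (assocHom p q r) A =
      p.functor.map (alphaInv q r A) ≫ alphaInv p (tri q r) A := by
  refine (tri p (tri q r)).hom_ext ?_ fun s d hu hv => ?_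
  · have nat : (tri p q).functor.map (r.proj A) ≫ alpha p q r.pos =
        alpha p q (r.functor.obj A) ≫ p.functor.map (q.functor.map (r.proj A)) :=
      (alphaIso p q).inv.naturality (r.proj A)
    have e₁ : alphaInv (tri p q) r A ≫ (tri (tri p q) r).proj A =
        (tri p q).functor.map (r.proj A) := alphaInv_proj _ _ _
    have e₂ : p.functor.map (alphaInv q r A) ≫ p.functor.map ((tri q r).proj A) =
        p.functor.map (q.functor.map (r.proj A)) :=
      (p.functor.map_comp _ _).symm.trans (congrArg p.functor.map (alphaInv_proj q r A))
    have e₃ : natApp (assocHom p q r) A ≫ (tri p (tri q r)).proj A =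
        (tri (tri p q) r).proj A ≫ alpha p q r.pos := natApp_proj _ _
    have e₄ := alphaInv_proj p (tri q r) A
    rw [Category.assoc, Category.assoc, Category.assoc, e₃, e₄, e₂, reassoc_of% e₁, nat,
      ← Category.assoc, alphaInv_alpha, Category.id_comp]
  have a₁ : s ≫ alphaInv p q (r.functor.obj A) ≫ alphaInv (tri p q) r A ≫
      natApp (assocHom p q r) A = ((s ≫ alphaInv p q (r.functor.obj A)) ≫
        alphaInv (tri p q) r A) ≫ natApp (assocHom p q r) A := by
    simp only [Category.assoc]
  have hu' := hu
  have hv' := hv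
  rw [a₁] at hu'
  rw [← Category.assoc s] at hv'
  refine ((tri p (tri q r)).eval_congr a₁ rfl _ hu').trans ?_
  refine Eq.trans ?_ ((tri p (tri q r)).eval_congr (Category.assoc _ _ _).symm rfl _ hv').symm
  have ha : (d ≫ triSnd p (tri q r)) ≫ triFst q r = d ≫ triSnd p (tri q r) ≫ triFst q r :=
    Category.assoc _ _ _
  have hb : (d ≫ triSnd p (tri q r)) ≫ triSnd q r = d ≫ triSnd p (tri q r) ≫ triSnd q r :=
    Category.assoc _ _ _
  obtain ⟨h₁, h₂⟩ := eval_alphaInv_cond p (tri q r) _ d hv'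
  have k₁ : s ≫ p.proj _ = (d ≫ triFst p (tri q r)) ≫ p.map := Eq.trans (by simp) h₁
  have e := p.eval_map (alphaInv q r A) s (d ≫ triFst p (tri q r)) h₁
  have h₂' := h₂
  rw [e] at h₂'
  obtain ⟨k₂, k₃⟩ := eval_alphaInv_cond q r _ _ h₂'
  have k₂' := k₂
  have k₃' := k₃
  simp only [ha, hb] at k₂' k₃'
  have rhs : (tri p (tri q r)).eval ((s ≫ p.functor.map (alphaInv q r A)) ≫
      alphaInv p (tri q r) A) d hv' = r.eval (q.eval (p.eval s (d ≫ triFst p (tri q r)) k₁)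
        (d ≫ triSnd p (tri q r) ≫ triFst q r) k₂')
        (d ≫ triSnd p (tri q r) ≫ triSnd q r) k₃' := by
    rw [eval_alphaInv]
    refine ((tri q r).eval_congr e rfl _ h₂').trans ?_
    rw [eval_alphaInv]
    exact r.eval_congr (q.eval_congr rfl ha _ _) hb _ _
  rw [rhs, eval_natApp]
  have h₀ : (((s ≫ alphaInv p q (r.functor.obj A)) ≫ alphaInv (tri p q) r A) ≫
      (tri (tri p q) r).proj A) ≫ ArrowLens.onPos (assocHom p q r) =
        d ≫ (tri p (tri q r)).map := by
    rw [← hu', Category.assoc _ (natApp _ _), natApp_proj, Category.assoc]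
  obtain ⟨l₁, l₂, l₃, l₄, hl⟩ := assocHom_app p q r _ d h₀
  refine ((tri (tri p q) r).eval_congr rfl hl _ (triMk_map (tri p q) r _ _ _ _ _).symm).trans ?_
  have m : (s ≫ alphaInv p q (r.functor.obj A)) ≫ (tri p q).proj _ =
      triMk p q ((((s ≫ alphaInv p q (r.functor.obj A)) ≫ alphaInv (tri p q) r A) ≫
        (tri (tri p q) r).proj A) ≫ (tri p q).proj r.pos) (d ≫ triFst p (tri q r))
        (d ≫ triSnd p (tri q r) ≫ triFst q r) l₁ l₂ ≫ triMap p q := by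
    have e₁ : alphaInv (tri p q) r A ≫ (tri (tri p q) r).proj A =
        (tri p q).functor.map (r.proj A) := alphaInv_proj _ _ _
    rw [triMk_map, Category.assoc _ (alphaInv (tri p q) r A), e₁, Category.assoc _ _
      ((tri p q).proj r.pos), map_proj]
  exact eval_alphaInv_triMk (p := tri p q) (q := r) _ _ _ _ m
    (eval_alphaInv_triMk (p := p) (q := q) s _ _ _ k₁ rfl k₂') k₃'

/-- The associator `(p ◁ q) ◁ r ≅ p ◁ (q ◁ r)`. -/
@[simps]
noncomputable def assocIso : tri (tri p q) r ≅ tri p (tri q r) where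
  hom := assocHom p q r
  inv := assocInv p q r
  hom_inv_id := by
    refine ArrowLens.ext (alpha_alphaInv p q r.pos) fun u d h h' => ?_
    refine (ArrowLens.comp_app' (assocHom p q r) (assocInv p q r) u d h).trans ?_
    refine Eq.trans ?_ (ArrowLens.id_app _ _ _).symm
    obtain ⟨h₁, h₂, h₃, h₄, e⟩ := assocInv_app p q r (u ≫ ArrowLens.onPos (assocHom p q r)) d
      ((Category.assoc _ _ _).trans h)
    refine (ArrowLens.app_congr rfl rfl e _ (triMk_map p (tri q r) _ _ _ _ _).symm).trans ?_
    obtain ⟨k₁, k₂, k₃, k₄, e'⟩ := assocHom_app p q r u _ (triMk_map p (tri q r) _ _ _ h₁ h₄).symm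
    refine e'.trans ?_
    have hu : u = d ≫ triMap (tri p q) r := (Category.comp_id u).symm.trans h'
    refine tri_hom_ext (p := tri p q) (q := r) ?_ ?_ ?_
    · rw [triMk_map]; exact hu
    · rw [triMk_fst]
      refine tri_hom_ext (p := p) (q := q) ?_ ?_ ?_
      · rw [triMk_map, hu, Category.assoc, Category.assoc]
        exact (d ≫= triFst_map (tri p q) r).symm
      · rw [triMk_fst, triMk_fst, Category.assoc]
      · rw [triMk_snd, triMk_snd_assoc, triMk_fst, Category.assoc]
    · rw [triMk_snd, triMk_snd_assoc, triMk_snd]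
  inv_hom_id := by
    refine ArrowLens.ext (alphaInv_alpha p q r.pos) fun w d h h' => ?_
    refine (ArrowLens.comp_app' (assocInv p q r) (assocHom p q r) w d h).trans ?_
    refine Eq.trans ?_ (ArrowLens.id_app _ _ _).symm
    obtain ⟨h₁, h₂, h₃, h₄, e⟩ := assocHom_app p q r (w ≫ ArrowLens.onPos (assocInv p q r)) d
      ((Category.assoc _ _ _).trans h)
    refine (ArrowLens.app_congr rfl rfl e _ (triMk_map (tri p q) r _ _ _ _ _).symm).trans ?_
    obtain ⟨k₁, k₂, k₃, k₄, e'⟩ := assocInv_app p q r w _ (triMk_map (tri p q) r _ _ _ h₃ h₄).symm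
    refine e'.trans ?_
    have hw : w = d ≫ triMap p (tri q r) := (Category.comp_id w).symm.trans h'
    refine tri_hom_ext (p := p) (q := tri q r) ?_ ?_ ?_
    · rw [triMk_map]; exact hw
    · rw [triMk_fst, triMk_fst_assoc, triMk_fst]
    · rw [triMk_snd]
      refine tri_hom_ext (p := q) (q := r) ?_ ?_ ?_
      · rw [triMk_map, ← (eval_of_eq p (tri q r) hw).snd]
        exact p.eval_congr rfl (by rw [triMk_fst_assoc, triMk_fst]) _ _
      · rw [triMk_fst, triMk_fst_assoc, triMk_snd, Category.assoc]
      · rw [triMk_snd, triMk_snd, Category.assoc]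

/-- The left unitor `y ◁ p ≅ p`. -/
@[simps]
noncomputable def leftIso : tri (y E) p ≅ p where
  hom := leftHom p
  inv := leftInv p
  hom_inv_id := by
    refine ArrowLens.ext (beta_betaInv p.pos) fun u d h h' => ?_
    refine (ArrowLens.comp_app' (leftHom p) (leftInv p) u d h).trans ?_
    refine Eq.trans ?_ (ArrowLens.id_app _ _ _).symm
    have hu : u = d ≫ triMap (y E) p := (Category.comp_id u).symm.trans h'
    have e := leftInv_app p (u ≫ ArrowLens.onPos (leftHom p)) d ((Category.assoc _ _ _).trans h)
    refine (ArrowLens.app_congr rfl rfl e _ ?_).trans ?_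
    · rw [← (eval_of_eq (y E) p hu).snd]
      exact comp_beta _ _ _
    obtain ⟨k, e'⟩ := leftHom_app p u (d ≫ triSnd (y E) p) (by
      rw [← (eval_of_eq (y E) p hu).snd]; exact comp_beta _ _ _)
    refine e'.trans (tri_hom_ext (p := y E) (q := p) ?_ (Subsingleton.elim _ _) ?_)
    · rw [triMk_map]; exact hu
    · rw [triMk_snd]
  inv_hom_id := by
    refine ArrowLens.ext (betaInv_beta p.pos) fun x a h h' => ?_
    refine (ArrowLens.comp_app' (leftInv p) (leftHom p) x a h).trans ?_
    refine Eq.trans ?_ (ArrowLens.id_app _ _ _).symm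
    refine (leftInv_app p _ _ _).trans ?_
    obtain ⟨k, e'⟩ := leftHom_app p (x ≫ ArrowLens.onPos (leftInv p)) a
      ((Category.assoc _ _ _).trans h)
    exact (congrArg (· ≫ triSnd (y E) p) e').trans (triMk_snd (y E) p _ _ _ _ _)

/-- The right unitor `p ◁ y ≅ p`. -/
@[simps]
noncomputable def rightIso : tri p (y E) ≅ p where
  hom := rightHom p
  inv := rightInv p
  hom_inv_id := by
    refine ArrowLens.ext ?_ fun u d h h' => ?_
    · refine p.hom_ext ?_ fun _ _ _ _ => Subsingleton.elim _ _
      change (p.proj (⊤_ E) ≫ p.curry (𝟙 _) (terminal.from _)) ≫ _ = 𝟙 _ ≫ _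
      rw [Category.assoc, curry_proj, Category.comp_id, Category.id_comp]
    refine (ArrowLens.comp_app' (rightHom p) (rightInv p) u d h).trans ?_
    refine Eq.trans ?_ (ArrowLens.id_app _ _ _).symm
    have hu : u = d ≫ triMap p (y E) := (Category.comp_id u).symm.trans h'
    have e := rightInv_app p (u ≫ ArrowLens.onPos (rightHom p)) d ((Category.assoc _ _ _).trans h)
    refine (ArrowLens.app_congr rfl rfl e _ (eval_of_eq p (y E) hu).fst).trans ?_
    refine (rightHom_app p u _ _).trans
      (tri_hom_ext (p := p) (q := y E) ?_ ?_ (Subsingleton.elim _ _))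
    · rw [triMk_map]; exact hu
    · rw [triMk_fst]
  inv_hom_id := by
    refine ArrowLens.ext (curry_proj _ _ _) fun x a h h' => ?_
    refine (ArrowLens.comp_app' (rightInv p) (rightHom p) x a h).trans ?_
    refine Eq.trans ?_ (ArrowLens.id_app _ _ _).symm
    refine (rightInv_app p _ _ _).trans ?_
    exact (congrArg (· ≫ triFst p (y E)) (rightHom_app p _ _ _)).trans
      (triMk_fst p (y E) _ _ _ _ _)

/-- The composition product, as the data of a monoidal structure. -/
noncomputable instance monoidalStruct : MonoidalCategoryStruct (Poly E) where
  tensorObj p q := tri p q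
  whiskerLeft p _ _ g := tensorLeft p g
  whiskerRight f q := tensorRight f q
  tensorHom {_ p' q _} f g := tensorRight f q ≫ tensorLeft p' g
  tensorUnit := y E
  associator p q r := assocIso p q r
  leftUnitor p := leftIso p
  rightUnitor p := rightIso p

attribute [local instance] endofunctorMonoidalCategory

variable (E) in
/-- The functor to endofunctors, whose tensor product is written in the reversed order. -/
noncomputable def toEndofunctorMop : Poly E ⥤ (E ⥤ E)ᴹᵒᵖ := toEndofunctor E ⋙ mopFunctor (E ⥤ E)

instance : (toEndofunctorMop E).Faithful where
  map_injective h := (toEndofunctor E).map_injective (congrArg Quiver.Hom.unmop h)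

theorem map_tensorLeft {q q' : Poly E} (g : q ⟶ q') :
    natTrans (tensorLeft p g) =
      (alphaIso p q).inv ≫ Functor.whiskerRight (natTrans g) p.functor ≫ (alphaIso p q').hom := by
  rw [Iso.eq_inv_comp]
  ext A
  exact natApp_tensorLeft p g A

theorem map_tensorRight {p p' : Poly E} (f : p ⟶ p') (q : Poly E) :
    natTrans (tensorRight f q) =
      (alphaIso p q).inv ≫ Functor.whiskerLeft q.functor (natTrans f) ≫ (alphaIso p' q).hom := by
  rw [Iso.eq_inv_comp]
  ext A
  exact natApp_tensorRight f q A

theorem map_leftHom : natTrans (leftHom p) =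
    (alphaIso (y E) p).inv ≫ Functor.whiskerLeft p.functor (betaIso (E := E)).inv := by
  rw [Iso.eq_inv_comp]
  ext A
  exact natApp_leftHom p A

theorem map_rightHom : natTrans (rightHom p) =
    (alphaIso p (y E)).inv ≫ Functor.whiskerRight (betaIso (E := E)).inv p.functor := by
  rw [Iso.eq_inv_comp]
  ext A
  exact natApp_rightHom p A

theorem map_assocHom : natTrans (assocHom p q r) =
    (alphaIso (tri p q) r).inv ≫ Functor.whiskerLeft r.functor (alphaIso p q).inv ≫
      Functor.whiskerRight (alphaIso q r).hom p.functor ≫ (alphaIso p (tri q r)).hom := by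
  rw [Iso.eq_inv_comp]
  ext A
  change _ = alpha p q (r.functor.obj A) ≫ p.functor.map (alphaInv q r A) ≫ alphaInv p (tri q r) A
  rw [← natApp_assocHom, ← Category.assoc (alpha p q _), alpha_alphaInv, Category.id_comp]
  rfl

/-- The functor to endofunctors preserves the operations. -/
noncomputable def inducingData : Monoidal.InducingFunctorData (toEndofunctorMop E) where
  μIso p q := (alphaIso p q).mop
  εIso := (betaIso (E := E)).mop
  whiskerLeft_eq p _ _ g := Quiver.Hom.unmop_inj (map_tensorLeft p g)
  whiskerRight_eq f q := Quiver.Hom.unmop_inj (map_tensorRight f q)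
  tensorHom_eq {p p' q q'} f g := Quiver.Hom.unmop_inj (by
    refine ((toEndofunctor E).map_comp (tensorRight f q) (tensorLeft p' g)).trans ?_
    refine (congrArg₂ (· ≫ ·) (map_tensorRight f q) (map_tensorLeft p' g)).trans ?_
    ext A
    change (alpha p q A ≫ natApp f (q.functor.obj A) ≫ alphaInv p' q A) ≫ alpha p' q A ≫
      p'.functor.map (natApp g A) ≫ alphaInv p' q' A = alpha p q A ≫
        (natApp f (q.functor.obj A) ≫ p'.functor.map (natApp g A)) ≫ alphaInv p' q' A
    have := alphaInv_alpha p' q A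
    simp only [Category.assoc]
    rw [reassoc_of% this])
  associator_eq p q r := Quiver.Hom.unmop_inj (by
    refine (map_assocHom p q r).trans ?_
    ext A
    change alpha (tri p q) r A ≫ alpha p q (r.functor.obj A) ≫
      p.functor.map (alphaInv q r A) ≫ alphaInv p (tri q r) A =
      (alpha (tri p q) r A ≫ (alpha p q (r.functor.obj A) ≫
        p.functor.map (q.functor.map (𝟙 (r.functor.obj A))))) ≫ 𝟙 _ ≫
        ((𝟙 _ ≫ p.functor.map (alphaInv q r A)) ≫ alphaInv p (tri q r) A)
    simp)
  leftUnitor_eq p := Quiver.Hom.unmop_inj (by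
    refine (map_leftHom p).trans ?_
    ext A
    change alpha (y E) p A ≫ beta (p.functor.obj A) =
      (alpha (y E) p A ≫ (beta (p.functor.obj A) ≫ 𝟙 (p.functor.obj A))) ≫ 𝟙 _
    simp)
  rightUnitor_eq p := Quiver.Hom.unmop_inj (by
    refine (map_rightHom p).trans ?_
    ext A
    change alpha p (y E) A ≫ p.functor.map (beta A) =
      (alpha p (y E) A ≫ (𝟙 _ ≫ p.functor.map (beta A))) ≫ 𝟙 _
    simp)

noncomputable instance : MonoidalCategory (Poly E) :=
  Monoidal.induced (toEndofunctorMop E) inducingData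

end Monoidal

section

variable (c : Poly E) [ComonObj c]

/-- The counit, as a morphism `c ⟶ y`. -/
abbrev counit : c ⟶ y E := ComonObj.counit

/-- The comultiplication, as a morphism `c ⟶ c ◁ c`. -/
abbrev comul : c ⟶ tri c c := ComonObj.comul

theorem counit_comul : comul c ≫ tensorRight (counit c) c = leftInv c := ComonObj.counit_comul c

theorem comul_counit : comul c ≫ tensorLeft c (counit c) = rightInv c := ComonObj.comul_counit c

theorem comul_assoc : comul c ≫ tensorLeft c (comul c) =
    comul c ≫ tensorRight (comul c) c ≫ assocHom c c c := ComonObj.comul_assoc c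

theorem natApp_comp {p q r : Poly E} (φ : p ⟶ q) (ψ : q ⟶ r) (A : E) :
    natApp (φ ≫ ψ) A = natApp φ A ≫ natApp ψ A :=
  congrArg (fun f => NatTrans.app f A) ((toEndofunctor E).map_comp φ ψ)

theorem natApp_id (p : Poly E) (A : E) : natApp (𝟙 p) A = 𝟙 _ :=
  congrArg (fun f => NatTrans.app f A) ((toEndofunctor E).map_id p)

/-- The comonad on `E` induced by a comonoid in polynomials: the functor `P(c)`, with counit
`P(c) ⟶ P(y) ≅ id` and comultiplication `P(c) ⟶ P(c ◁ c) ≅ P(c) ∘ P(c)`. -/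
noncomputable def comonad : Comonad E where
  toFunctor := c.functor
  ε := natTrans (counit c) ≫ (betaIso (E := E)).inv
  δ := natTrans (comul c) ≫ (alphaIso c c).inv
  left_counit A := by
    have h : (comul c ≫ tensorRight (counit c) c) ≫ leftHom c = 𝟙 c := by
      rw [counit_comul]; exact (leftIso c).inv_hom_id
    have h' := congrArg (fun φ : c ⟶ c => natApp φ A) h
    have e₁ : natApp (tensorRight (counit c) c) A = _ :=
      congrArg (fun f => NatTrans.app f A) (map_tensorRight (counit c) c)
    have e₂ : natApp (leftHom c) A = _ := congrArg (fun f => NatTrans.app f A) (map_leftHom c)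
    change (natApp (comul c) A ≫ alpha c c A) ≫ natApp (counit c) (c.functor.obj A) ≫
      beta (c.functor.obj A) = 𝟙 _
    rw [natApp_comp, natApp_comp, natApp_id, e₁, e₂] at h'
    rw [← h']
    change _ = (natApp (comul c) A ≫ alpha c c A ≫ natApp (counit c) (c.functor.obj A) ≫
      alphaInv (y E) c A) ≫ alpha (y E) c A ≫ beta (c.functor.obj A)
    simp only [Category.assoc]
    rw [reassoc_of% alphaInv_alpha (y E) c A]
  right_counit A := by
    have h : (comul c ≫ tensorLeft c (counit c)) ≫ rightHom c = 𝟙 c := by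
      rw [comul_counit]; exact (rightIso c).inv_hom_id
    have h' := congrArg (fun φ : c ⟶ c => natApp φ A) h
    have e₁ : natApp (tensorLeft c (counit c)) A = _ :=
      congrArg (fun f => NatTrans.app f A) (map_tensorLeft c (counit c))
    have e₂ : natApp (rightHom c) A = _ := congrArg (fun f => NatTrans.app f A) (map_rightHom c)
    change (natApp (comul c) A ≫ alpha c c A) ≫ c.functor.map (natApp (counit c) A ≫ beta A) = 𝟙 _
    rw [natApp_comp, natApp_comp, natApp_id, e₁, e₂] at h'
    rw [← h', c.functor.map_comp]
    change _ = (natApp (comul c) A ≫ alpha c c A ≫ c.functor.map (natApp (counit c) A) ≫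
      alphaInv c (y E) A) ≫ alpha c (y E) A ≫ c.functor.map (beta A)
    simp only [Category.assoc]
    rw [reassoc_of% alphaInv_alpha c (y E) A]
  coassoc A := by
    have h' := congrArg (fun φ : c ⟶ tri c (tri c c) => natApp φ A) (comul_assoc c)
    have e₁ : natApp (tensorLeft c (comul c)) A = _ :=
      congrArg (fun f => NatTrans.app f A) (map_tensorLeft c (comul c))
    have e₂ : natApp (tensorRight (comul c) c) A = _ :=
      congrArg (fun f => NatTrans.app f A) (map_tensorRight (comul c) c)
    have e₃ : natApp (assocHom c c c) A = _ :=
      congrArg (fun f => NatTrans.app f A) (map_assocHom c c c)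
    rw [natApp_comp, natApp_comp, natApp_comp, e₁, e₂, e₃] at h'
    change natApp (comul c) A ≫ alpha c c A ≫ c.functor.map (natApp (comul c) A) ≫
        alphaInv c (tri c c) A =
      natApp (comul c) A ≫ (alpha c c A ≫ natApp (comul c) (c.functor.obj A) ≫
        alphaInv (tri c c) c A) ≫ alpha (tri c c) c A ≫ alpha c c (c.functor.obj A) ≫
        c.functor.map (alphaInv c c A) ≫ alphaInv c (tri c c) A at h'
    change (natApp (comul c) A ≫ alpha c c A) ≫ c.functor.map (natApp (comul c) A ≫ alpha c c A) =
      (natApp (comul c) A ≫ alpha c c A) ≫ natApp (comul c) (c.functor.obj A) ≫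
        alpha c c (c.functor.obj A)
    simp only [Category.assoc] at h'
    rw [reassoc_of% alphaInv_alpha (tri c c) c A] at h'
    have h'' := congrArg (· ≫ alpha c (tri c c) A ≫ c.functor.map (alpha c c A)) h'
    have e₄ : c.functor.map (alphaInv c c A) ≫ c.functor.map (alpha c c A) = 𝟙 _ := by
      rw [← c.functor.map_comp, alphaInv_alpha, c.functor.map_id]
    simp only [Category.assoc, reassoc_of% alphaInv_alpha c (tri c c) A, e₄, Category.comp_id]
      at h''
    simpa only [Category.assoc, c.functor.map_comp] using h''

end

end Poly

variable (E) in
/-- A category internal to `E`. Composition is written in diagrammatic order: it is defined on pairs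
`(f, g)` such that the target of `f` is the source of `g`. -/
structure InternalCategory where
  obj : E
  mor : E
  src : mor ⟶ obj
  tgt : mor ⟶ obj
  ident : obj ⟶ mor
  comp : pullback tgt src ⟶ mor
  ident_src : ident ≫ src = 𝟙 obj
  ident_tgt : ident ≫ tgt = 𝟙 obj
  comp_src : comp ≫ src = pullback.fst tgt src ≫ src
  comp_tgt : comp ≫ tgt = pullback.snd tgt src ≫ tgt
  id_comp : pullback.lift (src ≫ ident) (𝟙 mor)
    (by rw [Category.assoc, ident_tgt, Category.comp_id, Category.id_comp]) ≫ comp = 𝟙 mor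
  comp_id : pullback.lift (𝟙 mor) (tgt ≫ ident)
    (by rw [Category.assoc, ident_src, Category.comp_id, Category.id_comp]) ≫ comp = 𝟙 mor
  assoc {T : E} (f g h : T ⟶ mor) (hfg : f ≫ tgt = g ≫ src) (hgh : g ≫ tgt = h ≫ src) :
    pullback.lift (pullback.lift f g hfg ≫ comp) h
        (by rw [Category.assoc, comp_tgt, pullback.lift_snd_assoc, hgh]) ≫ comp =
      pullback.lift f (pullback.lift g h hgh ≫ comp)
        (by rw [Category.assoc, comp_src, pullback.lift_fst_assoc, hfg]) ≫ comp

namespace InternalCategory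

variable (C : InternalCategory E)

/-- Composition of generalized elements. -/
noncomputable def compElt {T : E} (f g : T ⟶ C.mor) (h : f ≫ C.tgt = g ≫ C.src) : T ⟶ C.mor :=
  pullback.lift f g h ≫ C.comp

@[simp]
theorem compElt_src {T : E} (f g : T ⟶ C.mor) (h : f ≫ C.tgt = g ≫ C.src) :
    C.compElt f g h ≫ C.src = f ≫ C.src := by
  rw [compElt, Category.assoc, C.comp_src, pullback.lift_fst_assoc]

@[simp]
theorem compElt_tgt {T : E} (f g : T ⟶ C.mor) (h : f ≫ C.tgt = g ≫ C.src) :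
    C.compElt f g h ≫ C.tgt = g ≫ C.tgt := by
  rw [compElt, Category.assoc, C.comp_tgt, pullback.lift_snd_assoc]

variable {C} in
theorem compElt_congr {T : E} {f f' g g' : T ⟶ C.mor} (hf : f = f') (hg : g = g')
    (h : f ≫ C.tgt = g ≫ C.src) (h' : f' ≫ C.tgt = g' ≫ C.src) :
    C.compElt f g h = C.compElt f' g' h' := by
  subst hf hg; rfl

end InternalCategory

/-- An internal cofunctor from `D` to `C`: it goes forwards on objects, and it sends an object `x` of
`D` and a morphism `e` of `C` out of the image of `x` to a morphism of `D` out of `x`, compatibly with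
identities, targets and composition. -/
structure Cofunctor (D C : InternalCategory E) extends ArrowLens D.src C.src where
  app_ident {T : E} (x : T ⟶ D.obj) :
    toArrowLens.app x (x ≫ toArrowLens.onPos ≫ C.ident)
      (by simp only [Category.assoc, C.ident_src, Category.comp_id]) = x ≫ D.ident
  onPos_tgt {T : E} (x : T ⟶ D.obj) (e : T ⟶ C.mor) (h : x ≫ toArrowLens.onPos = e ≫ C.src) :
    toArrowLens.app x e h ≫ D.tgt ≫ toArrowLens.onPos = e ≫ C.tgt
  app_compElt {T : E} (x : T ⟶ D.obj) (e e' : T ⟶ C.mor) (h : x ≫ toArrowLens.onPos = e ≫ C.src)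
    (h' : e ≫ C.tgt = e' ≫ C.src) :
    toArrowLens.app x (C.compElt e e' h') (by rw [C.compElt_src, h]) =
      D.compElt (toArrowLens.app x e h)
        (toArrowLens.app (toArrowLens.app x e h ≫ D.tgt) e'
          (by rw [Category.assoc, onPos_tgt x e h, h']))
        (by rw [ArrowLens.app_comp])

namespace Cofunctor

variable {B C D : InternalCategory E}

theorem ext {F G : Cofunctor D C} (h : F.toArrowLens = G.toArrowLens) : F = G := by
  obtain ⟨F, _⟩ := F
  obtain ⟨G, _⟩ := G
  obtain rfl : F = G := h
  rfl

/-- The identity cofunctor. -/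
noncomputable def id (C : InternalCategory E) : Cofunctor C C where
  toArrowLens := ArrowLens.id C.src
  app_ident x := by rw [ArrowLens.id_app, ArrowLens.id_onPos, Category.id_comp]
  onPos_tgt x e h := by rw [ArrowLens.id_app, ArrowLens.id_onPos, Category.comp_id]
  app_compElt x e e' h h' := by
    rw [ArrowLens.id_app]
    exact InternalCategory.compElt_congr (ArrowLens.id_app _ _ _).symm
      (ArrowLens.id_app _ _ _).symm _ _

/-- Composition of cofunctors. -/
noncomputable def comp (F : Cofunctor B C) (G : Cofunctor C D) : Cofunctor B D where
  toArrowLens := F.toArrowLens.comp G.toArrowLens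
  app_ident x := by
    rw [ArrowLens.comp_app', ← F.app_ident x]
    refine ArrowLens.app_congr rfl rfl ?_ _ _
    refine Eq.trans ?_ ((G.app_ident (x ≫ F.onPos)).trans (Category.assoc _ _ _))
    exact ArrowLens.app_congr rfl rfl (by simp) _ _
  onPos_tgt x e h := by
    have h₁ : (x ≫ F.onPos) ≫ G.onPos = e ≫ D.src := by rw [Category.assoc]; exact h
    have h₂ : x ≫ F.onPos = G.app (x ≫ F.onPos) e h₁ ≫ C.src := by rw [ArrowLens.app_comp]
    have e₁ := congrArg (· ≫ G.onPos) (F.onPos_tgt x _ h₂)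
    have e₂ := G.onPos_tgt _ _ h₁
    refine (congrArg (· ≫ B.tgt ≫ F.onPos ≫ G.onPos) (ArrowLens.comp_app' _ _ _ _ _)).trans ?_
    simp only [Category.assoc] at e₁ e₂ ⊢
    exact e₁.trans e₂
  app_compElt x e e' h h' := by
    have h₁ : (x ≫ F.onPos) ≫ G.onPos = e ≫ D.src := by rw [Category.assoc]; exact h
    have h₂ : x ≫ F.onPos = G.app (x ≫ F.onPos) e h₁ ≫ C.src := by rw [ArrowLens.app_comp]
    have h₃ : G.app (x ≫ F.onPos) e h₁ ≫ C.tgt =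
        G.app (G.app (x ≫ F.onPos) e h₁ ≫ C.tgt) e'
          (by rw [Category.assoc, G.onPos_tgt _ _ h₁, h']) ≫ C.src := by rw [ArrowLens.app_comp]
    rw [ArrowLens.comp_app']
    refine (ArrowLens.app_congr rfl rfl (G.app_compElt (x ≫ F.onPos) e e' h₁ h') _
      (by rw [C.compElt_src, ArrowLens.app_comp])).trans ?_
    rw [F.app_compElt x _ _ h₂ h₃]
    refine InternalCategory.compElt_congr (ArrowLens.comp_app' _ _ _ _ _).symm ?_ _ _
    rw [ArrowLens.comp_app']
    have e₁ : F.app x (G.app (x ≫ F.onPos) e h₁) h₂ ≫ B.tgt =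
      (F.toArrowLens.comp G.toArrowLens).app x e h ≫ B.tgt := by rw [ArrowLens.comp_app']
    refine ArrowLens.app_congr rfl e₁ (ArrowLens.app_congr rfl ?_ rfl _ _) _ _
    rw [← e₁, Category.assoc, F.onPos_tgt x _ h₂]

end Cofunctor

/-- An internal copresheaf (or internal discrete opfibration) on `C` is a cofunctor into `C` from
some internal category, whose underlying morphism of arrows is cartesian. -/
structure InternalCopresheaf (C : InternalCategory E) where
  total : InternalCategory E
  proj : Cofunctor total C
  isCartesian : proj.IsCartesian

namespace InternalCopresheaf

variable {C : InternalCategory E}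

/-- A morphism of internal copresheaves is a cofunctor commuting over `C`. -/
structure Hom (X Y : InternalCopresheaf C) where
  cofunctor : Cofunctor X.total Y.total
  w : cofunctor.comp Y.proj = X.proj

theorem Hom.ext {X Y : InternalCopresheaf C} {F G : Hom X Y}
    (h : F.cofunctor.toArrowLens = G.cofunctor.toArrowLens) : F = G := by
  obtain ⟨F, _⟩ := F
  obtain ⟨G, _⟩ := G
  obtain rfl : F = G := Cofunctor.ext h
  rfl

noncomputable instance : Category (InternalCopresheaf C) where
  Hom X Y := Hom X Y
  id X := ⟨Cofunctor.id X.total, Cofunctor.ext (ArrowLens.id_comp _)⟩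
  comp {_ _ Z} F G := ⟨F.cofunctor.comp G.cofunctor, Cofunctor.ext
    ((ArrowLens.assoc _ _ Z.proj.toArrowLens).trans
      (congrArg Cofunctor.toArrowLens ((congrArg F.cofunctor.comp G.w).trans F.w)))⟩
  id_comp _ := Hom.ext (ArrowLens.id_comp _)
  comp_id _ := Hom.ext (ArrowLens.comp_id _)
  assoc _ _ _ := Hom.ext (ArrowLens.assoc _ _ _)

end InternalCopresheaf

namespace Poly

section

variable (c : Poly E) [ComonObj c]

/-- The comultiplication on positions, `C ⟶ P(c)(C)`. -/
noncomputable abbrev comulPos : c.pos ⟶ c.functor.obj c.pos := ArrowLens.onPos (comul c)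

theorem comulPos_proj : comulPos c ≫ c.proj c.pos = 𝟙 c.pos := by
  have h : comulPos c ≫ c.functor.map (ArrowLens.onPos (counit c)) =
      c.curry (𝟙 _) (terminal.from _) := congrArg ArrowLens.onPos (comul_counit c)
  have := congrArg (· ≫ c.proj (⊤_ E)) h
  simpa only [Category.assoc, curry_proj, map_proj] using this

/-- The target map of a comonoid: a direction `e` at `x` is sent to the value of `δ x` at `e`. -/
noncomputable def target : c.dir ⟶ c.pos :=
  c.eval (c.map ≫ comulPos c) (𝟙 _)
    (by rw [Category.assoc, comulPos_proj, Category.comp_id, Category.id_comp])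

/-- The identities of a comonoid: `x` is sent to the direction `ε♯ x`. -/
noncomputable def identity : c.pos ⟶ c.dir :=
  onDirApp (counit c) (𝟙 _) (terminal.from _) (Subsingleton.elim _ _)

theorem identity_map : identity c ≫ c.map = 𝟙 c.pos := ArrowLens.app_comp _ _ _ _

variable {c}

theorem eval_comulPos {T : E} (x : T ⟶ c.pos) (f : T ⟶ c.dir)
    (h : (x ≫ comulPos c) ≫ c.proj c.pos = f ≫ c.map) :
    c.eval (x ≫ comulPos c) f h = f ≫ target c := by
  have hx : x = f ≫ c.map := by
    rw [← h, Category.assoc, comulPos_proj, Category.comp_id]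
  refine Eq.trans ?_ (c.comp_eval _ _ _ _).symm
  exact c.eval_congr (by rw [hx, Category.assoc]) (Category.comp_id f).symm _ _

theorem comulPos_cond {T : E} (x : T ⟶ c.pos) (f : T ⟶ c.dir) (h : x = f ≫ c.map) :
    (x ≫ comulPos c) ≫ c.proj c.pos = f ≫ c.map := by
  rw [Category.assoc, comulPos_proj, Category.comp_id, h]

/-- The direction `(f, g)` of `c ◁ c` at `δ x` given by a direction `f` at `x` and a direction `g` at
the target of `f`. -/
noncomputable def comulMk {T : E} (f g : T ⟶ c.dir) (h : f ≫ target c = g ≫ c.map) :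
    T ⟶ triDir c c :=
  triMk c c ((f ≫ c.map) ≫ comulPos c) f g (comulPos_cond _ _ rfl) ((eval_comulPos _ _ _).trans h)

/-- The composition of a comonoid: directions `f` at `x` and `g` at the target of `f` are sent to the
direction `δ♯ (x, (f, g))` at `x`. -/
noncomputable def composite {T : E} (f g : T ⟶ c.dir) (h : f ≫ target c = g ≫ c.map) :
    T ⟶ c.dir :=
  onDirApp (comul c) (f ≫ c.map) (comulMk f g h) (triMk_map c c _ _ _ _ _).symm

theorem composite_map {T : E} (f g : T ⟶ c.dir) (h : f ≫ target c = g ≫ c.map) :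
    composite f g h ≫ c.map = f ≫ c.map := ArrowLens.app_comp _ _ _ _

theorem composite_congr {T : E} {f f' g g' : T ⟶ c.dir} (hf : f = f') (hg : g = g')
    (h : f ≫ target c = g ≫ c.map) (h' : f' ≫ target c = g' ≫ c.map) :
    composite f g h = composite f' g' h' := by
  subst hf hg; rfl

theorem comp_composite {S T : E} (s : S ⟶ T) (f g : T ⟶ c.dir)
    (h : f ≫ target c = g ≫ c.map) :
    s ≫ composite f g h = composite (s ≫ f) (s ≫ g)
      (by rw [Category.assoc, h, Category.assoc]) := by
  refine (ArrowLens.comp_app _ _ _ _ _).trans ?_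
  refine ArrowLens.app_congr rfl (Category.assoc _ _ _).symm ?_ _ _
  refine (comp_triMk c c _ _ _ _ _ _).trans ?_
  exact triMk_congr (p := c) (q := c) _ _ (by simp only [Category.assoc]) rfl rfl _ _

theorem app_comul_triMk {T : E} {x : T ⟶ c.pos} {u : T ⟶ (tri c c).pos} {f g : T ⟶ c.dir}
    (hx : x = f ≫ c.map) (h : u ≫ c.proj c.pos = f ≫ c.map) (h' : c.eval u f h = g ≫ c.map)
    (h'' : x ≫ comulPos c = triMk c c u f g h h' ≫ triMap c c)
    (k : f ≫ target c = g ≫ c.map) :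
    onDirApp (comul c) x (triMk c c u f g h h') h'' = composite f g k := by
  have hu : u = (f ≫ c.map) ≫ comulPos c := by rw [← hx, h'', triMk_map]
  exact ArrowLens.app_congr rfl hx (triMk_congr (p := c) (q := c) _ _ hu rfl rfl _ _) _ _

theorem identity_target : identity c ≫ target c = 𝟙 c.pos := by
  have h : comulPos c ≫ natApp (counit c) c.pos = betaInv c.pos :=
    congrArg ArrowLens.onPos (counit_comul c)
  have k : (comulPos c ≫ natApp (counit c) c.pos) ≫ (y E).proj c.pos =
    terminal.from c.pos ≫ (y E).map := Subsingleton.elim _ _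
  have h₁ := (y E).eval_congr (h.trans (Category.id_comp _).symm) rfl k (Subsingleton.elim _ _)
  rw [eval_natApp, eval_betaInv] at h₁
  rw [← h₁, ← eval_comulPos (𝟙 _) (identity c) (by
    rw [Category.id_comp, comulPos_proj, identity_map])]
  refine c.eval_congr (Category.id_comp _) ?_ _ _
  exact ArrowLens.app_congr rfl (comulPos_proj c).symm rfl _ _

theorem composite_target {T : E} (f g : T ⟶ c.dir) (h : f ≫ target c = g ≫ c.map) :
    composite f g h ≫ target c = g ≫ target c := by
  have hc : comulPos c ≫ c.functor.map (comulPos c) =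
      comulPos c ≫ natApp (comul c) c.pos ≫ alpha c c c.pos :=
    congrArg ArrowLens.onPos (comul_assoc c)
  let v := (f ≫ c.map) ≫ comulPos c
  let u := v ≫ natApp (comul c) c.pos
  have hv : v ≫ c.proj c.pos = f ≫ c.map := comulPos_cond _ _ rfl
  have huv : v ≫ c.functor.map (comulPos c) = u ≫ alpha c c c.pos := by
    simp only [v, u, Category.assoc, hc]
  have k : (v ≫ c.functor.map (comulPos c)) ≫ c.proj _ = f ≫ c.map := by
    rw [Category.assoc, map_proj, hv]
  have k' : (u ≫ alpha c c c.pos) ≫ c.proj _ = f ≫ c.map := by rw [← huv, k]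
  have e₁ : c.eval (u ≫ alpha c c c.pos) f k' = (f ≫ target c) ≫ comulPos c := by
    refine (c.eval_congr huv.symm rfl _ k).trans ?_
    rw [eval_map]
    exact congrArg (· ≫ comulPos c) (eval_comulPos _ _ _)
  have k'' : (𝟙 _ ≫ c.eval (u ≫ alpha c c c.pos) f k') ≫ c.proj c.pos = g ≫ c.map := by
    rw [Category.id_comp, e₁]
    exact comulPos_cond _ _ h
  have e₂ := eval_eval_alpha c c (𝟙 _) u f g k' k''
  have e₃ : c.eval (𝟙 _ ≫ c.eval (u ≫ alpha c c c.pos) f k') g k'' = g ≫ target c := by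
    refine (c.eval_congr ((Category.id_comp _).trans e₁) rfl _ (comulPos_cond _ _ h)).trans ?_
    exact eval_comulPos _ _ _
  rw [← e₃, e₂]
  have hu : u ≫ (tri c c).proj c.pos = v := by
    simp only [u, Category.assoc, natApp_proj]
    rw [← Category.assoc, hv]
  have m : (v ≫ natApp (comul c) c.pos) ≫ (tri c c).proj c.pos =
      comulMk f g h ≫ (tri c c).map := hu.trans (triMk_map c c _ _ _ _ _).symm
  symm
  refine ((tri c c).eval_congr (Category.id_comp u) ?_ _ m).trans ?_
  · exact triMk_congr (p := c) (q := c) _ _ ((Category.id_comp _).trans hu) (Category.id_comp _)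
      rfl _ _
  rw [eval_natApp]
  refine Eq.trans ?_ (eval_comulPos (f ≫ c.map) (composite f g h)
    (comulPos_cond _ _ (composite_map f g h).symm))
  exact c.eval_congr rfl (ArrowLens.app_congr rfl hv rfl _ _) _ _

theorem identity_composite {T : E} (x : T ⟶ c.pos) (g : T ⟶ c.dir)
    (h : (x ≫ identity c) ≫ target c = g ≫ c.map) : composite (x ≫ identity c) g h = g := by
  have hx : x = g ≫ c.map := by
    rw [← h, Category.assoc, identity_target, Category.comp_id]
  let d : T ⟶ triDir (y E) c := triMk (y E) c (x ≫ betaInv c.pos) (terminal.from T) g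
    (Subsingleton.elim _ _) ((eval_betaInv _ _ _).trans hx)
  have hd : x ≫ ArrowLens.onPos (leftInv c) = d ≫ (tri (y E) c).map :=
    (triMk_map (y E) c _ _ _ _ _).symm
  have hd' : x ≫ ArrowLens.onPos (comul c ≫ tensorRight (counit c) c) = d ≫ (tri (y E) c).map := by
    rw [counit_comul, hd]
  have e₁ := (ArrowLens.app_congr (counit_comul c) rfl rfl hd' hd).trans
    ((leftInv_app c x d hd).trans (triMk_snd (y E) c _ _ _ _ _))
  refine Eq.trans ?_ e₁
  refine Eq.trans ?_ (ArrowLens.comp_app' (comul c) (tensorRight (counit c) c) x d hd').symm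
  have ef : onDirApp (counit c) ((x ≫ comulPos c) ≫ c.proj c.pos) (d ≫ triFst (y E) c)
      (Subsingleton.elim _ _) = x ≫ identity c := by
    refine Eq.trans ?_ (ArrowLens.comp_app _ _ _ _ _).symm
    exact ArrowLens.app_congr rfl (by rw [Category.assoc, comulPos_proj])
      (Subsingleton.elim _ _) _ _
  have eg : d ≫ triSnd (y E) c = g := triMk_snd (y E) c _ _ _ _ _
  have k := comulPos_cond x (x ≫ identity c) (by
    rw [Category.assoc, identity_map, Category.comp_id])
  have k₂ : c.eval (x ≫ comulPos c) (onDirApp (counit c) ((x ≫ comulPos c) ≫ c.proj c.pos)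
      (d ≫ triFst (y E) c) (Subsingleton.elim _ _)) (by rw [ArrowLens.app_comp]) =
        (d ≫ triSnd (y E) c) ≫ c.map := by
    refine (c.eval_congr rfl ef _ k).trans ?_
    rw [eval_comulPos, h, eg]
  have e₂ := tensorRight_app (counit c) c (x ≫ comulPos c) d
    ((Category.assoc _ _ _).trans hd') (Subsingleton.elim _ _) k₂
  refine Eq.symm ((ArrowLens.app_congr rfl rfl e₂ _ (triMk_map c c _ _ _ _ _).symm).trans ?_)
  refine (app_comul_triMk (c := c) ?_ _ _ _ ?_).trans (composite_congr ef eg _ _)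
  · rw [ef, Category.assoc, identity_map, Category.comp_id]
  · rw [ef, eg, h]

theorem composite_identity {T : E} (f : T ⟶ c.dir) (x : T ⟶ c.pos)
    (h : f ≫ target c = (x ≫ identity c) ≫ c.map) : composite f (x ≫ identity c) h = f := by
  have hx : f ≫ target c = x := by
    rw [h, Category.assoc, identity_map, Category.comp_id]
  let z : T ⟶ c.pos := f ≫ c.map
  have hz : (z ≫ ArrowLens.onPos (rightInv c)) ≫ c.proj _ = f ≫ c.map := by
    refine (Category.assoc _ _ _).trans ((z ≫= c.curry_proj _ _).trans ?_)
    rw [Category.comp_id]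
  let d : T ⟶ triDir c (y E) := triMk c (y E) (z ≫ ArrowLens.onPos (rightInv c)) f
    (terminal.from T) hz (Subsingleton.elim _ _)
  have hd : z ≫ ArrowLens.onPos (rightInv c) = d ≫ (tri c (y E)).map :=
    (triMk_map c (y E) _ _ _ _ _).symm
  have hd' : z ≫ ArrowLens.onPos (comul c ≫ tensorLeft c (counit c)) = d ≫ (tri c (y E)).map := by
    rw [comul_counit, hd]
  have ef : d ≫ triFst c (y E) = f := triMk_fst c (y E) _ _ _ _ _
  have e₁ := (ArrowLens.app_congr (comul_counit c) rfl rfl hd' hd).trans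
    ((rightInv_app c z d hd).trans ef)
  refine Eq.trans ?_ e₁
  refine Eq.trans ?_ (ArrowLens.comp_app' (comul c) (tensorLeft c (counit c)) z d hd').symm
  have k : (z ≫ comulPos c) ≫ c.proj c.pos = (d ≫ triFst c (y E)) ≫ c.map := by
    rw [ef]; exact comulPos_cond _ _ rfl
  have e₂ := tensorLeft_app c (counit c) (z ≫ comulPos c) d
    ((Category.assoc _ _ _).trans hd') k (Subsingleton.elim _ _)
  have ev : c.eval (z ≫ comulPos c) (d ≫ triFst c (y E)) k = x := by
    rw [eval_comulPos, ef, hx]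
  have eg : onDirApp (counit c) (c.eval (z ≫ comulPos c) (d ≫ triFst c (y E)) k)
      (d ≫ triSnd c (y E)) (Subsingleton.elim _ _) = x ≫ identity c := by
    refine Eq.trans ?_ (ArrowLens.comp_app _ _ _ _ _).symm
    exact ArrowLens.app_congr rfl (ev.trans (Category.comp_id _).symm)
      (Subsingleton.elim _ _) _ _
  refine Eq.symm ((ArrowLens.app_congr rfl rfl e₂ _ (triMk_map c c _ _ _ _ _).symm).trans ?_)
  refine (app_comul_triMk (c := c) ?_ _ _ _ ?_).trans (composite_congr ef eg _ _)
  · rw [ef]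
  · rw [eg, ef, h]

theorem composite_assoc {T : E} (f g e : T ⟶ c.dir) (h : f ≫ target c = g ≫ c.map)
    (h' : g ≫ target c = e ≫ c.map) :
    composite (composite f g h) e (by rw [composite_target, h']) =
      composite f (composite g e h') (by rw [composite_map, h]) := by
  let z : T ⟶ c.pos := f ≫ c.map
  let w := (z ≫ comulPos c) ≫ c.functor.map (comulPos c)
  have kw₀ := comulPos_cond z f rfl
  have kw : w ≫ c.proj _ = f ≫ c.map := by
    rw [Category.assoc, map_proj, kw₀]
  have ew : c.eval w f kw = (g ≫ c.map) ≫ comulPos c := by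
    rw [eval_map, eval_comulPos, h]
  let d : T ⟶ triDir c (tri c c) := triMk c (tri c c) w f (comulMk g e h') kw
    (ew.trans (triMk_map c c _ _ _ _ _).symm)
  have df : d ≫ triFst c (tri c c) = f := triMk_fst c (tri c c) _ _ _ _ _
  have ds : d ≫ triSnd c (tri c c) = comulMk g e h' := triMk_snd c (tri c c) _ _ _ _ _
  have dsf : d ≫ triSnd c (tri c c) ≫ triFst c c = g := by
    rw [← Category.assoc, ds]; exact triMk_fst c c _ _ _ _ _
  have dss : d ≫ triSnd c (tri c c) ≫ triSnd c c = e := by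
    rw [← Category.assoc, ds]; exact triMk_snd c c _ _ _ _ _
  have hd : z ≫ ArrowLens.onPos (comul c ≫ tensorLeft c (comul c)) =
      d ≫ (tri c (tri c c)).map :=
    (Category.assoc _ _ _).symm.trans (triMk_map c (tri c c) _ _ _ _ _).symm
  have hd' : z ≫ ArrowLens.onPos (comul c ≫ tensorRight (comul c) c ≫ assocHom c c c) =
      d ≫ (tri c (tri c c)).map := by rw [← comul_assoc, hd]
  have main := ArrowLens.app_congr (comul_assoc c) rfl rfl hd hd'
  have lhs : ArrowLens.app (comul c ≫ tensorLeft c (comul c)) z d hd =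
      composite f (composite g e h') (by rw [composite_map, h]) := by
    refine (ArrowLens.comp_app' (comul c) (tensorLeft c (comul c)) z d hd).trans ?_
    have k : (z ≫ comulPos c) ≫ c.proj c.pos = (d ≫ triFst c (tri c c)) ≫ c.map := by
      rw [df, kw₀]
    have ev : c.eval (z ≫ comulPos c) (d ≫ triFst c (tri c c)) k = g ≫ c.map := by
      rw [eval_comulPos, df, h]
    have k₂ : c.eval (z ≫ comulPos c) (d ≫ triFst c (tri c c)) k ≫ comulPos c =
        (d ≫ triSnd c (tri c c)) ≫ (tri c c).map := by
      rw [ev, ds]; exact (triMk_map c c _ _ _ _ _).symm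
    have e₂ := tensorLeft_app c (comul c) (z ≫ comulPos c) d
      ((Category.assoc _ _ _).trans hd) k k₂
    have eg : onDirApp (comul c) (c.eval (z ≫ comulPos c) (d ≫ triFst c (tri c c)) k)
        (d ≫ triSnd c (tri c c)) k₂ = composite g e h' := ArrowLens.app_congr rfl ev ds _ _
    refine (ArrowLens.app_congr rfl rfl e₂ _ (triMk_map c c _ _ _ _ _).symm).trans ?_
    refine (app_comul_triMk (c := c) ?_ _ _ _ ?_).trans (composite_congr df eg _ _)
    · rw [df]
    · rw [eg, df, composite_map, h]
  have rhs : ArrowLens.app (comul c ≫ tensorRight (comul c) c ≫ assocHom c c c) z d hd' =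
      composite (composite f g h) e (by rw [composite_target, h']) := by
    refine (ArrowLens.comp_app' (comul c) (tensorRight (comul c) c ≫ assocHom c c c) z d
      hd').trans ?_
    have hd₁ : (z ≫ comulPos c) ≫ ArrowLens.onPos (tensorRight (comul c) c ≫ assocHom c c c) =
        d ≫ (tri c (tri c c)).map := (Category.assoc _ _ _).trans hd'
    have e₀ := ArrowLens.comp_app' (tensorRight (comul c) c) (assocHom c c c) (z ≫ comulPos c) d hd₁
    let U := (z ≫ comulPos c) ≫ ArrowLens.onPos (tensorRight (comul c) c)
    obtain ⟨h₁, h₂, h₃, h₄, ea⟩ := assocHom_app c c c U d ((Category.assoc _ _ _).trans hd₁)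
    have hM := (triMk_map (tri c c) c U _ _ h₃ h₄).symm
    have Mf := triMk_fst (tri c c) c U _ _ h₃ h₄
    have Ms := (triMk_snd (tri c c) c U _ _ h₃ h₄).trans dss
    set M := triMk (tri c c) c U _ _ h₃ h₄
    have hz : (z ≫ comulPos c) ≫ c.proj c.pos = z := by
      rw [Category.assoc, comulPos_proj, Category.comp_id]
    have kM := (eval_of_eq (tri c c) c hM).fst
    have q₁ : ((z ≫ comulPos c) ≫ c.proj c.pos) ≫ comulPos c =
        (M ≫ triFst (tri c c) c) ≫ (tri c c).map := by
      rw [← kM]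
      exact (Category.assoc _ _ _).trans (((z ≫ comulPos c) ≫= (natApp_proj (comul c) c.pos).symm).trans
        (Category.assoc _ _ _).symm)
    have q₁' : z ≫ comulPos c = (M ≫ triFst (tri c c) c) ≫ (tri c c).map := by rw [← q₁, hz]
    have eF : onDirApp (comul c) ((z ≫ comulPos c) ≫ c.proj c.pos) (M ≫ triFst (tri c c) c) q₁ =
        composite f g h := by
      refine (ArrowLens.app_congr rfl hz Mf _ (q₁'.trans (congrArg (· ≫ (tri c c).map) Mf))).trans ?_
      refine (app_comul_triMk (c := c) (by rw [df]) _ _ _ (by rw [df, dsf, h])).trans ?_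
      exact composite_congr df dsf _ _
    have q₂ : c.eval (z ≫ comulPos c) (onDirApp (comul c) ((z ≫ comulPos c) ≫ c.proj c.pos)
        (M ≫ triFst (tri c c) c) q₁) (by rw [ArrowLens.app_comp]) =
          (M ≫ triSnd (tri c c) c) ≫ c.map := by
      rw [eval_comulPos, eF, Ms, composite_target, h']
    have e₁ := tensorRight_app (comul c) c (z ≫ comulPos c) M hM q₁ q₂
    have e₂ := (e₀.trans (ArrowLens.app_congr rfl rfl ea _ hM)).trans e₁
    refine (ArrowLens.app_congr rfl rfl e₂ _ (triMk_map c c _ _ _ _ _).symm).trans ?_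
    refine (app_comul_triMk (c := c) ?_ _ _ _ ?_).trans (composite_congr eF Ms _ _)
    · rw [eF, composite_map]
    · rw [eF, Ms, composite_target, h']
  rw [← rhs, ← main, lhs]

variable (c)

/-- The internal category of a comonoid `c` in polynomials. Its source map is `c` itself. -/
noncomputable def internalCategory : InternalCategory E where
  obj := c.pos
  mor := c.dir
  src := c.map
  tgt := target c
  ident := identity c
  comp := composite (pullback.fst (target c) c.map) (pullback.snd (target c) c.map)
    pullback.condition
  ident_src := identity_map c
  ident_tgt := identity_target
  comp_src := composite_map _ _ _
  comp_tgt := composite_target _ _ _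
  id_comp := by
    rw [comp_composite]
    refine (composite_congr (pullback.lift_fst _ _ _) (pullback.lift_snd _ _ _) _ ?_).trans
      (identity_composite _ _ _)
    simp [identity_target]
  comp_id := by
    rw [comp_composite]
    refine (composite_congr (pullback.lift_fst _ _ _) (pullback.lift_snd _ _ _) _ ?_).trans
      (composite_identity _ _ _)
    simp [identity_map]
  assoc f g h hfg hgh := by
    have e : ∀ {T : E} (f g : T ⟶ c.dir) (h : f ≫ target c = g ≫ c.map), pullback.lift f g h ≫
        composite (pullback.fst (target c) c.map) (pullback.snd (target c) c.map)
          pullback.condition = composite f g h := fun f g h => by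
      rw [comp_composite]
      exact composite_congr (pullback.lift_fst _ _ _) (pullback.lift_snd _ _ _) _ _
    refine (e _ _ _).trans (Eq.trans ?_ (e _ _ _).symm)
    refine (composite_congr (e _ _ _) rfl _ (by rw [composite_target, hgh])).trans
      ((composite_assoc f g h hfg hgh).trans ?_)
    exact composite_congr rfl (e _ _ _).symm _ _

end

end Poly

end Polynomials

end InternalPoly

/-!
Both categories are equivalent to the category of actions of the internal category of `c`.

A morphism `S ⟶ P(c)(S)` is, by currying, an anchor `S ⟶ C` together with a map sending an element
`s` of `S` and a direction `e` of `c` over its anchor to an element `s • e` of `S`. Evaluated on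
generalized elements, the counit law says that identities act trivially, and the comultiplication
law says that `s • e` lies over the target of `e` and that `s • (g ∘ f) = (s • f) • g`.

A cofunctor `D ⟶ C` makes `C` act on the objects of `D` by sending an object to the target of the
lift of a morphism of `C`. If the cofunctor is cartesian, then a morphism of `D` is determined by
its source and its image in `C`; hence morphisms of copresheaves are the equivariant morphisms on
objects, and every action comes from its category of elements.
-/

namespace InternalPoly

attribute [local simp] pullback.lift_fst pullback.lift_snd pullback.lift_fst_assoc
  pullback.lift_snd_assoc

variable {E : Type u} [Category.{v} E] [HasFiniteLimits E]

namespace ArrowLens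

variable {A B A' B' : E} {p : A ⟶ B} {q : A' ⟶ B'} (φ : ArrowLens p q) [IsIso φ.onDir]

/-- For a cartesian morphism `φ` from `p` to `q`, the morphism `A ⟶ A'` which makes `p` the pullback
of `q` along `φ.onPos`. -/
noncomputable def label : A ⟶ A' := inv φ.onDir ≫ pullback.snd φ.onPos q

theorem inv_onDir_fst : inv φ.onDir ≫ pullback.fst φ.onPos q = p :=
  (IsIso.inv_comp_eq _).2 φ.onDir_comp.symm

theorem label_comp : φ.label ≫ q = p ≫ φ.onPos := by
  rw [label, Category.assoc, ← pullback.condition, reassoc_of% φ.inv_onDir_fst]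

theorem app_label {T : E} (x : T ⟶ B) (e : T ⟶ A') (h : x ≫ φ.onPos = e ≫ q) :
    φ.app x e h ≫ φ.label = e := by
  simp [label, app]

theorem hom_ext_label {T : E} {d d' : T ⟶ A} (h : d ≫ p = d' ≫ p)
    (h' : d ≫ φ.label = d' ≫ φ.label) : d = d' := by
  rw [← cancel_mono (inv φ.onDir)]
  apply pullback.hom_ext
  · simpa only [Category.assoc, inv_onDir_fst] using h
  · simpa only [Category.assoc, label] using h'

theorem app_comp_label {T : E} {x : T ⟶ B} {d : T ⟶ A} (hx : x = d ≫ p)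
    (h : x ≫ φ.onPos = (d ≫ φ.label) ≫ q) : φ.app x (d ≫ φ.label) h = d :=
  φ.hom_ext_label (by rw [app_comp, hx]) (φ.app_label _ _ _)

end ArrowLens

/-- An action of a morphism `p : A ⟶ B`: a direction `e` in `A` over the anchor of an element `s`
of the carrier moves `s` to an element `s • e`, about which nothing is required. For a polynomial
`p` these are the coalgebras of the endofunctor `P(p)`; for the source map of an internal category
they are the data of an action of this category. -/
structure ArrowAction {A B : E} (p : A ⟶ B) where
  carrier : E
  anchor : carrier ⟶ B
  act : pullback anchor p ⟶ carrier

namespace ArrowAction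

variable {A B : E} {p : A ⟶ B}

/-- The action on generalized elements. -/
noncomputable def smul (X : ArrowAction p) {T : E} (s : T ⟶ X.carrier) (e : T ⟶ A)
    (h : s ≫ X.anchor = e ≫ p) : T ⟶ X.carrier :=
  pullback.lift s e h ≫ X.act

theorem smul_congr (X : ArrowAction p) {T : E} {s s' : T ⟶ X.carrier} {e e' : T ⟶ A}
    (hs : s = s') (he : e = e') (h : s ≫ X.anchor = e ≫ p) (h' : s' ≫ X.anchor = e' ≫ p) :
    X.smul s e h = X.smul s' e' h' := by
  subst hs he; rfl

theorem comp_smul (X : ArrowAction p) {S T : E} (t : S ⟶ T) (s : T ⟶ X.carrier) (e : T ⟶ A)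
    (h : s ≫ X.anchor = e ≫ p) :
    t ≫ X.smul s e h = X.smul (t ≫ s) (t ≫ e) (by simp only [Category.assoc, h]) := by
  rw [smul, smul, ← Category.assoc]
  congr 1
  apply pullback.hom_ext <;> simp

theorem comp_act (X : ArrowAction p) {T : E} (d : T ⟶ pullback X.anchor p) :
    d ≫ X.act = X.smul (d ≫ pullback.fst X.anchor p) (d ≫ pullback.snd X.anchor p)
      (by rw [Category.assoc, pullback.condition, Category.assoc]) := by
  rw [← comp_smul _ _ _ _ pullback.condition, smul, pullback.lift_fst_snd, Category.id_comp]

/-- Equivariance of a morphism between the carriers of two actions of `p`. -/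
structure IsEquivariant (X Y : ArrowAction p) (f : X.carrier ⟶ Y.carrier) : Prop where
  comp_anchor : f ≫ Y.anchor = X.anchor
  smul_comp {T : E} (s : T ⟶ X.carrier) (e : T ⟶ A) (h : s ≫ X.anchor = e ≫ p) :
    X.smul s e h ≫ f = Y.smul (s ≫ f) e (by rw [Category.assoc, comp_anchor, h])

namespace IsEquivariant

variable {X Y Z : ArrowAction p}

theorem id (X : ArrowAction p) : IsEquivariant X X (𝟙 X.carrier) where
  comp_anchor := Category.id_comp _
  smul_comp s e h := by simp only [Category.comp_id]

theorem comp {f : X.carrier ⟶ Y.carrier} {g : Y.carrier ⟶ Z.carrier} (hf : IsEquivariant X Y f)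
    (hg : IsEquivariant Y Z g) : IsEquivariant X Z (f ≫ g) where
  comp_anchor := by rw [Category.assoc, hg.comp_anchor, hf.comp_anchor]
  smul_comp s e h := by
    rw [← Category.assoc, hf.smul_comp, hg.smul_comp]
    exact Z.smul_congr (Category.assoc _ _ _) rfl _ _

end IsEquivariant

/-- A morphism of actions of `p`. -/
structure Hom (X Y : ArrowAction p) where
  hom : X.carrier ⟶ Y.carrier
  isEquivariant : IsEquivariant X Y hom

theorem Hom.ext {X Y : ArrowAction p} {f g : Hom X Y} (h : f.hom = g.hom) : f = g := by
  obtain ⟨f, _⟩ := f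
  obtain ⟨g, _⟩ := g
  obtain rfl : f = g := h
  rfl

noncomputable instance : Category (ArrowAction p) where
  Hom := Hom
  id X := ⟨𝟙 X.carrier, IsEquivariant.id X⟩
  comp f g := ⟨f.hom ≫ g.hom, f.isEquivariant.comp g.isEquivariant⟩
  id_comp _ := Hom.ext (Category.id_comp _)
  comp_id _ := Hom.ext (Category.comp_id _)
  assoc _ _ _ := Hom.ext (Category.assoc _ _ _)

end ArrowAction

namespace InternalCategory

variable (C : InternalCategory E)

theorem comp_compElt {S T : E} (s : S ⟶ T) (f g : T ⟶ C.mor) (h : f ≫ C.tgt = g ≫ C.src) :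
    s ≫ C.compElt f g h = C.compElt (s ≫ f) (s ≫ g) (by simp only [Category.assoc, h]) := by
  rw [compElt, compElt, ← Category.assoc]
  congr 1
  apply pullback.hom_ext <;> simp

theorem ident_compElt {T : E} (g : T ⟶ C.mor) :
    C.compElt (g ≫ C.src ≫ C.ident) g (by simp only [Category.assoc, C.ident_tgt,
      Category.comp_id]) = g := by
  have h := g ≫= C.id_comp
  rw [← compElt, comp_compElt] at h
  simpa only [Category.comp_id] using h

theorem compElt_ident {T : E} (f : T ⟶ C.mor) :
    C.compElt f (f ≫ C.tgt ≫ C.ident) (by simp only [Category.assoc, C.ident_src,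
      Category.comp_id]) = f := by
  have h := f ≫= C.comp_id
  rw [← compElt, comp_compElt] at h
  simpa only [Category.comp_id] using h

theorem compElt_assoc {T : E} (f g h : T ⟶ C.mor) (hfg : f ≫ C.tgt = g ≫ C.src)
    (hgh : g ≫ C.tgt = h ≫ C.src) :
    C.compElt (C.compElt f g hfg) h (by rw [compElt_tgt, hgh]) =
      C.compElt f (C.compElt g h hgh) (by rw [compElt_src, hfg]) :=
  C.assoc f g h hfg hgh

/-- The axioms of an action of an internal category `C`: `s • e` lies over the target of `e`, and
`s • id = s` and `s • (g ∘ f) = (s • f) • g`. -/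
structure IsAction (X : ArrowAction C.src) : Prop where
  smul_anchor {T : E} (s : T ⟶ X.carrier) (f : T ⟶ C.mor) (h : s ≫ X.anchor = f ≫ C.src) :
    X.smul s f h ≫ X.anchor = f ≫ C.tgt
  smul_ident {T : E} (s : T ⟶ X.carrier) :
    X.smul s (s ≫ X.anchor ≫ C.ident) (by simp only [Category.assoc, C.ident_src,
      Category.comp_id]) = s
  smul_compElt {T : E} (s : T ⟶ X.carrier) (f g : T ⟶ C.mor) (h : s ≫ X.anchor = f ≫ C.src)
    (h' : f ≫ C.tgt = g ≫ C.src) :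
    X.smul s (C.compElt f g h') (by rw [compElt_src, h]) =
      X.smul (X.smul s f h) g (by rw [smul_anchor, h'])

/-- The category of actions of an internal category, with equivariant morphisms. -/
abbrev Action : Type _ := ObjectProperty.FullSubcategory C.IsAction

namespace IsAction

variable {C} {X : ArrowAction C.src} (hX : C.IsAction X)

include hX

theorem act_anchor : X.act ≫ X.anchor = pullback.snd X.anchor C.src ≫ C.tgt := by
  have h := hX.smul_anchor _ _ (pullback.condition (f := X.anchor) (g := C.src))
  rwa [ArrowAction.smul, pullback.lift_fst_snd, Category.id_comp] at h

theorem act_eq_fst_cond {T : E} {d d' : T ⟶ pullback X.anchor C.src}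
    (h : d ≫ X.act = d' ≫ pullback.fst _ _) :
    (d ≫ pullback.snd _ _) ≫ C.tgt = (d' ≫ pullback.snd _ _) ≫ C.src := by
  rw [Category.assoc, ← hX.act_anchor, reassoc_of% h, pullback.condition, Category.assoc]

/-- Composition in the category of elements, `((s, f), (s • f, g)) ↦ (s, g ∘ f)`. -/
noncomputable def elementsComp :
    pullback X.act (pullback.fst X.anchor C.src) ⟶ pullback X.anchor C.src :=
  pullback.lift (pullback.fst _ _ ≫ pullback.fst _ _)
    (C.compElt (pullback.fst _ _ ≫ pullback.snd _ _) (pullback.snd _ _ ≫ pullback.snd _ _)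
      (hX.act_eq_fst_cond pullback.condition))
    (by rw [compElt_src, Category.assoc, pullback.condition, Category.assoc])

theorem lift_elementsComp {T : E} (d d' : T ⟶ pullback X.anchor C.src)
    (h : d ≫ X.act = d' ≫ pullback.fst _ _) :
    pullback.lift d d' h ≫ hX.elementsComp = pullback.lift (d ≫ pullback.fst _ _)
      (C.compElt (d ≫ pullback.snd _ _) (d' ≫ pullback.snd _ _) (hX.act_eq_fst_cond h))
      (by rw [compElt_src, Category.assoc, pullback.condition, Category.assoc]) := by
  apply pullback.hom_ext <;> simp [elementsComp, comp_compElt]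

theorem elementsComp_act :
    hX.elementsComp ≫ X.act = pullback.snd X.act (pullback.fst X.anchor C.src) ≫ X.act := by
  rw [X.comp_act, X.comp_act]
  simp only [elementsComp, pullback.lift_fst, pullback.lift_snd]
  rw [hX.smul_compElt _ _ _ (by simp only [Category.assoc, pullback.condition])]
  refine X.smul_congr ?_ rfl _ _
  rw [← X.comp_act, pullback.condition]

/-- The category of elements of an action: its objects are the elements `s` of the carrier and its
morphisms `s ⟶ s • e` are the pairs `(s, e)` of an element and a morphism out of its anchor. -/
noncomputable abbrev elements : InternalCategory E where
  obj := X.carrier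
  mor := pullback X.anchor C.src
  src := pullback.fst _ _
  tgt := X.act
  ident := pullback.lift (𝟙 _) (X.anchor ≫ C.ident)
    (by rw [Category.assoc, C.ident_src, Category.comp_id, Category.id_comp])
  comp := hX.elementsComp
  ident_src := pullback.lift_fst _ _ _
  ident_tgt := by
    simpa only [Category.id_comp, ArrowAction.smul] using hX.smul_ident (𝟙 _)
  comp_src := pullback.lift_fst _ _ _
  comp_tgt := hX.elementsComp_act
  id_comp := by
    rw [lift_elementsComp]
    apply pullback.hom_ext <;> simp [pullback.condition_assoc, ident_compElt]
  comp_id := by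
    rw [lift_elementsComp]
    apply pullback.hom_ext <;> simp [reassoc_of% hX.act_anchor, compElt_ident]
  assoc f g h hfg hgh := by
    simp only [lift_elementsComp]
    apply pullback.hom_ext
    · simp
    · simpa using C.compElt_assoc _ _ _ (hX.act_eq_fst_cond hfg) (hX.act_eq_fst_cond hgh)

/-- The projection from the category of elements. -/
noncomputable def elementsProj : Cofunctor hX.elements C where
  onPos := X.anchor
  onDir := 𝟙 _
  onDir_comp := Category.id_comp _
  app_ident x := by
    simp only [ArrowLens.app, Category.comp_id]
    apply pullback.hom_ext <;> simp
  onPos_tgt x e h := by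
    simp only [ArrowLens.app, Category.comp_id]
    rw [← Category.assoc]
    exact hX.smul_anchor x e h
  app_compElt x e e' h h' := by
    simp only [ArrowLens.app, Category.comp_id]
    refine Eq.trans ?_ (hX.lift_elementsComp _ _ _).symm
    apply pullback.hom_ext <;> simp

end IsAction

end InternalCategory

namespace Cofunctor

variable {B C D : InternalCategory E}

/-- The action of `C` on the objects of `D` given by a cofunctor from `D` to `C`: a morphism of `C`
moves an object of `D` along its lift to `D`. -/
noncomputable abbrev action (F : Cofunctor D C) : ArrowAction C.src where
  carrier := D.obj
  anchor := F.onPos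
  act := F.onDir ≫ D.tgt

theorem action_smul (F : Cofunctor D C) {T : E} (x : T ⟶ D.obj) (e : T ⟶ C.mor)
    (h : x ≫ F.onPos = e ≫ C.src) : F.action.smul x e h = F.app x e h ≫ D.tgt :=
  (Category.assoc _ _ _).symm

theorem isAction_action (F : Cofunctor D C) : C.IsAction F.action where
  smul_anchor x e h := by rw [action_smul, Category.assoc, F.onPos_tgt x e h]
  smul_ident x := by rw [action_smul, F.app_ident, Category.assoc, D.ident_tgt, Category.comp_id]
  smul_compElt x e e' h h' := by
    simp only [action_smul, F.app_compElt x e e' h h', InternalCategory.compElt_tgt]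

theorem isEquivariant_onPos (F : Cofunctor B D) (G : Cofunctor D C) :
    ArrowAction.IsEquivariant (F.comp G).action G.action F.onPos where
  comp_anchor := rfl
  smul_comp x e h := by
    rw [action_smul, action_smul, Category.assoc,
      ← F.onPos_tgt x _ (ArrowLens.app_comp _ _ _ _).symm]
    exact congrArg (· ≫ B.tgt ≫ F.onPos) (ArrowLens.comp_app' _ _ _ _ _)

section Cartesian

variable (G : Cofunctor D C) [IsIso G.onDir]

theorem label_tgt : G.label ≫ C.tgt = D.tgt ≫ G.onPos := by
  have h : D.src ≫ G.onPos = (𝟙 _ ≫ G.label) ≫ C.src := by rw [Category.id_comp, G.label_comp]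
  rw [← Category.id_comp G.label, ← G.onPos_tgt _ _ h,
    G.app_comp_label (Category.id_comp _).symm, Category.id_comp]

theorem ident_label : D.ident ≫ G.label = G.onPos ≫ C.ident := by
  rw [← Category.id_comp D.ident, ← G.app_ident, G.app_label, Category.id_comp]

theorem compElt_label {T : E} (d d' : T ⟶ D.mor) (h : d ≫ D.tgt = d' ≫ D.src) :
    D.compElt d d' h ≫ G.label = C.compElt (d ≫ G.label) (d' ≫ G.label)
      (by rw [Category.assoc, G.label_tgt, reassoc_of% h, Category.assoc, G.label_comp]) := by
  have hd : (d ≫ D.src) ≫ G.onPos = (d ≫ G.label) ≫ C.src := by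
    simp only [Category.assoc, G.label_comp]
  have hd' : (d ≫ G.label) ≫ C.tgt = (d' ≫ G.label) ≫ C.src := by
    rw [Category.assoc, G.label_tgt, reassoc_of% h, Category.assoc, G.label_comp]
  rw [← G.app_label _ _ ((hd.trans (C.compElt_src _ _ hd').symm)), G.app_compElt _ _ _ hd hd']
  simp only [G.app_comp_label, h]

theorem app_eq_of_comp_eq {F : Cofunctor B C} {H : Cofunctor B D} (w : H.comp G = F) {T : E}
    (x : T ⟶ B.obj) (d : T ⟶ D.mor) (h : x ≫ H.onPos = d ≫ D.src)
    (h' : x ≫ F.onPos = (d ≫ G.label) ≫ C.src) :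
    H.app x d h = F.app x (d ≫ G.label) h' := by
  subst w
  refine Eq.trans ?_ (ArrowLens.comp_app' H.toArrowLens G.toArrowLens x _ h').symm
  exact ArrowLens.app_congr rfl rfl (G.app_comp_label h _).symm _ _

section Lift

variable {F : Cofunctor B C} {G} {f : B.obj ⟶ D.obj}

theorem comp_onPos_eq_label (hf : f ≫ G.onPos = F.onPos) {T : E} (x : T ⟶ B.obj) (d : T ⟶ D.mor)
    (h : x ≫ f = d ≫ D.src) : x ≫ F.onPos = (d ≫ G.label) ≫ C.src := by
  rw [← hf, reassoc_of% h, Category.assoc, G.label_comp]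

/-- The morphism of arrows underlying the lift of a cofunctor `F` through a cartesian cofunctor `G`:
a morphism `d` of `D` is sent to the morphism of `B` which `F` assigns to the label of `d`. -/
noncomputable def liftLens (hf : f ≫ G.onPos = F.onPos) : ArrowLens B.src D.src :=
  ArrowLens.ofElements f (fun x d h => F.app x (d ≫ G.label) (comp_onPos_eq_label hf x d h))
    fun _ _ _ => ArrowLens.app_comp _ _ _ _

theorem liftLens_app (hf : f ≫ G.onPos = F.onPos) {T : E} (x : T ⟶ B.obj) (d : T ⟶ D.mor)
    (h : x ≫ (liftLens hf).onPos = d ≫ D.src) : (liftLens hf).app x d h =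
      F.app x (d ≫ G.label) (comp_onPos_eq_label hf x d h) :=
  ArrowLens.ofElements_app f _ (fun _ _ _ => ArrowLens.app_comp _ _ _ _)
    (fun _ _ _ _ => by simp only [ArrowLens.comp_app, Category.assoc]) x d h

/-- The lift of a cofunctor `F` through a cartesian cofunctor `G` determined by an equivariant
morphism on objects. -/
noncomputable def lift (hf : ArrowAction.IsEquivariant F.action G.action f) : Cofunctor B D where
  toArrowLens := liftLens hf.comp_anchor
  app_ident x := by
    have hx : (x ≫ (liftLens hf.comp_anchor).onPos ≫ D.ident) ≫ G.label =
        x ≫ F.onPos ≫ C.ident := by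
      rw [Category.assoc, Category.assoc, G.ident_label]
      exact x ≫= (Category.assoc _ _ _).symm.trans (hf.comp_anchor =≫ C.ident)
    simp only [liftLens_app, hx, F.app_ident]
  onPos_tgt x d h := by
    have hx := hf.smul_comp x (d ≫ G.label) (comp_onPos_eq_label hf.comp_anchor x d h)
    rw [action_smul, action_smul, Category.assoc] at hx
    rw [liftLens_app]
    exact hx.trans (congrArg (· ≫ D.tgt) (G.app_comp_label h _))
  app_compElt x d d' h h' := by
    have hd := comp_onPos_eq_label hf.comp_anchor x d h
    have hd' : (d ≫ G.label) ≫ C.tgt = (d' ≫ G.label) ≫ C.src := by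
      rw [Category.assoc, G.label_tgt, reassoc_of% h', Category.assoc, G.label_comp]
    simp only [liftLens_app, compElt_label, F.app_compElt x _ _ hd hd']

theorem lift_comp (hf : ArrowAction.IsEquivariant F.action G.action f) : (lift hf).comp G = F := by
  refine ext (ArrowLens.ext hf.comp_anchor fun x e h h' => ?_)
  refine (ArrowLens.comp_app' (liftLens hf.comp_anchor) G.toArrowLens x e h).trans ?_
  simp only [liftLens_app, G.app_label]

end Lift

end Cartesian

end Cofunctor

theorem InternalCategory.IsAction.elementsProj_action {C : InternalCategory E}
    {X : ArrowAction C.src} (hX : C.IsAction X) : hX.elementsProj.action = X :=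
  congrArg (ArrowAction.mk X.carrier X.anchor) (Category.id_comp X.act)

namespace InternalCopresheaf

variable {C : InternalCategory E}

instance (X : InternalCopresheaf C) : IsIso X.proj.onDir := X.isCartesian

variable (C) in
/-- The functor sending a copresheaf to the action of its base on the objects of its total
category. -/
noncomputable def toAction : InternalCopresheaf C ⥤ C.Action where
  obj X := ⟨X.proj.action, X.proj.isAction_action⟩
  map {_ Y} F :=
    ObjectProperty.homMk ⟨F.cofunctor.onPos, F.w ▸ F.cofunctor.isEquivariant_onPos Y.proj⟩

instance : (toAction C).Faithful where
  map_injective {X Y F G} h := by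
    have onPos_eq : F.cofunctor.onPos = G.cofunctor.onPos := congrArg (·.hom.hom) h
    refine Hom.ext (ArrowLens.ext onPos_eq fun x d hF hG => ?_)
    have hx : x ≫ X.proj.onPos = (d ≫ Y.proj.label) ≫ C.src :=
      Cofunctor.comp_onPos_eq_label (congrArg (·.onPos) F.w) x d hF
    rw [Cofunctor.app_eq_of_comp_eq Y.proj F.w x d hF hx,
      Cofunctor.app_eq_of_comp_eq Y.proj G.w x d hG hx]

instance : (toAction C).Full where
  map_surjective f :=
    ⟨⟨Cofunctor.lift f.hom.isEquivariant, Cofunctor.lift_comp _⟩, rfl⟩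

instance : (toAction C).EssSurj where
  mem_essImage X :=
    ⟨⟨X.property.elements, X.property.elementsProj, inferInstanceAs (IsIso (𝟙 _))⟩,
      ⟨ObjectProperty.isoMk _ (eqToIso X.property.elementsProj_action)⟩⟩

instance : (toAction C).IsEquivalence where

end InternalCopresheaf

namespace Poly

theorem curry_eval (p : Poly E) {A T : E} (u : T ⟶ p.functor.obj A) :
    p.curry (u ≫ p.proj A) (p.eval (pullback.fst (u ≫ p.proj A) p.map ≫ u) (pullback.snd _ _)
      (by rw [Category.assoc, pullback.condition])) = u := by
  refine p.hom_ext (p.curry_proj _ _) fun s e hu hv => ?_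
  rw [eval_comp_curry, comp_eval]
  exact p.eval_congr (by simp) (by simp) _ _

theorem hom_ext_of_eval_eval (p q : Poly E) {A T : E} {u v : T ⟶ p.functor.obj (q.functor.obj A)}
    (h_proj : u ≫ p.proj _ = v ≫ p.proj _)
    (h_eval_proj : ∀ {S : E} (s : S ⟶ T) (e : S ⟶ p.dir) (hu : (s ≫ u) ≫ p.proj _ = e ≫ p.map)
      (hv : (s ≫ v) ≫ p.proj _ = e ≫ p.map),
      p.eval (s ≫ u) e hu ≫ q.proj A = p.eval (s ≫ v) e hv ≫ q.proj A)
    (h_eval : ∀ {S : E} (s : S ⟶ T) (e : S ⟶ p.dir) (d : S ⟶ q.dir)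
      (hu : (s ≫ u) ≫ p.proj _ = e ≫ p.map) (hv : (s ≫ v) ≫ p.proj _ = e ≫ p.map)
      (hu' : p.eval (s ≫ u) e hu ≫ q.proj A = d ≫ q.map)
      (hv' : p.eval (s ≫ v) e hv ≫ q.proj A = d ≫ q.map),
      q.eval (p.eval (s ≫ u) e hu) d hu' = q.eval (p.eval (s ≫ v) e hv) d hv') :
    u = v := by
  refine p.hom_ext h_proj fun s e hu hv => q.hom_ext (h_eval_proj s e hu hv) fun t d hu' hv' => ?_
  simp only [comp_eval, ← Category.assoc t s] at hu' hv' ⊢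
  exact h_eval (t ≫ s) (t ≫ e) d _ _ hu' hv'

end Poly

namespace ArrowAction

variable {p : Poly E}

/-- The coalgebra structure `s ↦ (s.anchor, e ↦ s • e)` on the carrier of an action. -/
noncomputable def coaction (X : ArrowAction p.map) : X.carrier ⟶ p.functor.obj X.carrier :=
  p.curry X.anchor X.act

/-- The action on `S` with `coaction` a given morphism. -/
noncomputable abbrev ofCoaction {S : E} (u : S ⟶ p.functor.obj S) : ArrowAction p.map where
  carrier := S
  anchor := u ≫ p.proj S
  act := p.eval (pullback.fst (u ≫ p.proj S) p.map ≫ u) (pullback.snd _ _)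
    (by rw [Category.assoc, pullback.condition])

theorem coaction_ofCoaction {S : E} (u : S ⟶ p.functor.obj S) : (ofCoaction u).coaction = u :=
  p.curry_eval u

theorem coaction_proj (X : ArrowAction p.map) : X.coaction ≫ p.proj _ = X.anchor :=
  p.curry_proj _ _

theorem comp_coaction_proj (X : ArrowAction p.map) {T : E} (s : T ⟶ X.carrier) :
    (s ≫ X.coaction) ≫ p.proj _ = s ≫ X.anchor := by
  rw [Category.assoc, coaction_proj]

theorem eval_coaction (X : ArrowAction p.map) {T : E} (s : T ⟶ X.carrier) (e : T ⟶ p.dir)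
    (h : (s ≫ X.coaction) ≫ p.proj _ = e ≫ p.map) :
    p.eval (s ≫ X.coaction) e h = X.smul s e ((comp_coaction_proj X s).symm.trans h) :=
  p.eval_comp_curry s X.anchor X.act e h

theorem eval_coaction_map (X : ArrowAction p.map) {A T : E} (f : X.carrier ⟶ A)
    (s : T ⟶ X.carrier) (e : T ⟶ p.dir)
    (h : (s ≫ X.coaction ≫ p.functor.map f) ≫ p.proj _ = e ≫ p.map) :
    p.eval (s ≫ X.coaction ≫ p.functor.map f) e h =
      X.smul s e (by simpa [coaction_proj] using h) ≫ f := by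
  have hs : ((s ≫ X.coaction) ≫ p.functor.map f) ≫ p.proj _ = e ≫ p.map := by
    rwa [Category.assoc s]
  rw [← eval_coaction X s e (by simpa using h), ← p.eval_map f _ _ hs]
  exact p.eval_congr (Category.assoc _ _ _).symm rfl _ _

theorem isEquivariant_iff_coaction {X Y : ArrowAction p.map} (f : X.carrier ⟶ Y.carrier) :
    IsEquivariant X Y f ↔ X.coaction ≫ p.functor.map f = f ≫ Y.coaction := by
  constructor
  · intro hf
    refine p.hom_ext ?_ fun s e hu hv => ?_
    · rw [Category.assoc, p.map_proj, comp_coaction_proj, coaction_proj, hf.comp_anchor]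
    · simp only [eval_coaction_map, ← Category.assoc s f, eval_coaction, hf.smul_comp]
  · intro hf
    have comp_anchor : f ≫ Y.anchor = X.anchor := by
      rw [← comp_coaction_proj, ← hf, Category.assoc, p.map_proj, coaction_proj]
    refine ⟨comp_anchor, fun s e h => ?_⟩
    have hs : (s ≫ X.coaction ≫ p.functor.map f) ≫ p.proj _ = e ≫ p.map := by
      simpa [coaction_proj] using h
    rw [← eval_coaction_map X f s e hs]
    simp only [hf, ← Category.assoc, eval_coaction]

end ArrowAction

namespace Poly

variable {c : Poly E} [ComonObj c]

variable (c) in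
/-- The counit of the comonad `P(c)`, as a morphism of `E`. -/
noncomputable def extract (A : E) : c.functor.obj A ⟶ A := natApp (counit c) A ≫ beta A

variable (c) in
/-- The comultiplication of the comonad `P(c)`, as a morphism of `E`. -/
noncomputable def duplicate (A : E) : c.functor.obj A ⟶ c.functor.obj (c.functor.obj A) :=
  natApp (comul c) A ≫ alpha c c A

theorem comp_extract {A T : E} (w : T ⟶ c.functor.obj A) :
    w ≫ extract c A = c.eval w (w ≫ c.proj A ≫ identity c)
      (by simp only [Category.assoc, identity_map, Category.comp_id]) := by
  have app_counit : ArrowLens.app (counit c) (w ≫ c.proj A) (terminal.from T)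
      (Subsingleton.elim _ _) = w ≫ c.proj A ≫ identity c := by
    rw [← Category.assoc w, identity, onDirApp, ArrowLens.comp_app]
    exact ArrowLens.app_congr rfl (Category.comp_id _).symm (Subsingleton.elim _ _) _ _
  rw [extract, ← Category.assoc, comp_beta _ (terminal.from T) (Subsingleton.elim _ _),
    eval_natApp]
  exact c.eval_congr rfl app_counit _ _

theorem comp_natApp_comul_proj {A T : E} (w : T ⟶ c.functor.obj A) :
    (w ≫ natApp (comul c) A) ≫ (tri c c).proj A = (w ≫ c.proj A) ≫ comulPos c := by
  rw [Category.assoc, natApp_proj, ← Category.assoc]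

theorem comp_duplicate {A T : E} (w : T ⟶ c.functor.obj A) :
    w ≫ duplicate c A = (w ≫ natApp (comul c) A) ≫ alpha c c A :=
  (Category.assoc _ _ _).symm

theorem comp_duplicate_proj {A T : E} (w : T ⟶ c.functor.obj A) :
    (w ≫ duplicate c A) ≫ c.proj _ = w ≫ c.proj A := by
  rw [comp_duplicate, Category.assoc, alpha_proj, ← Category.assoc, comp_natApp_comul_proj,
    Category.assoc, comulPos_proj, Category.comp_id]

theorem eval_duplicate_proj {A T : E} (w : T ⟶ c.functor.obj A) (f : T ⟶ c.dir)
    (h : (w ≫ duplicate c A) ≫ c.proj _ = f ≫ c.map) :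
    c.eval (w ≫ duplicate c A) f h ≫ c.proj A = f ≫ target c := by
  simp only [comp_duplicate, eval_alpha_proj, comp_natApp_comul_proj, eval_comulPos]

theorem eval_eval_duplicate {A T : E} (w : T ⟶ c.functor.obj A) (f g : T ⟶ c.dir)
    (h : (w ≫ duplicate c A) ≫ c.proj _ = f ≫ c.map) (h' : f ≫ target c = g ≫ c.map) :
    c.eval (c.eval (w ≫ duplicate c A) f h) g ((eval_duplicate_proj w f h).trans h') =
      c.eval w (composite f g h')
        (by rw [composite_map, ← h, comp_duplicate_proj]) := by
  have hw : w ≫ c.proj A = f ≫ c.map := (comp_duplicate_proj w).symm.trans h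
  have eval_eval := eval_eval_alpha c c (𝟙 T) (w ≫ natApp (comul c) A) f g
    (by rwa [← comp_duplicate])
    (by simpa only [Category.id_comp, ← comp_duplicate, eval_duplicate_proj] using h')
  simp only [Category.id_comp, ← comp_duplicate, comp_natApp_comul_proj, eval_natApp] at eval_eval
  rw [eval_eval]
  exact c.eval_congr rfl (app_comul_triMk hw _ _ _ h') _ _

theorem internalCategory_compElt {T : E} (f g : T ⟶ c.dir) (h : f ≫ target c = g ≫ c.map) :
    c.internalCategory.compElt f g h = composite f g h :=
  (comp_composite _ _ _ _).trans
    (composite_congr (pullback.lift_fst _ _ _) (pullback.lift_snd _ _ _) _ _)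

variable {X : ArrowAction c.map}

theorem coaction_extract_iff : X.coaction ≫ extract c _ = 𝟙 _ ↔
    ∀ {T : E} (s : T ⟶ X.carrier), X.smul s (s ≫ X.anchor ≫ identity c)
      (by simp only [Category.assoc, identity_map, Category.comp_id]) = s := by
  have comp_coaction_extract {T : E} (s : T ⟶ X.carrier) : s ≫ X.coaction ≫ extract c _ =
      X.smul s (s ≫ X.anchor ≫ identity c)
        (by simp only [Category.assoc, identity_map, Category.comp_id]) := by
    rw [← Category.assoc, comp_extract, X.eval_coaction]
    exact X.smul_congr rfl (by rw [Category.assoc, reassoc_of% X.coaction_proj]) _ _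
  simp only [← comp_coaction_extract]
  exact ⟨fun h _ s => by rw [h, Category.comp_id], fun h => by simpa using h (𝟙 _)⟩

theorem coaction_duplicate_iff :
    X.coaction ≫ duplicate c _ = X.coaction ≫ c.functor.map X.coaction ↔
      ∃ smul_anchor : ∀ {T : E} (s : T ⟶ X.carrier) (f : T ⟶ c.dir)
        (h : s ≫ X.anchor = f ≫ c.map), X.smul s f h ≫ X.anchor = f ≫ target c,
      ∀ {T : E} (s : T ⟶ X.carrier) (f g : T ⟶ c.dir) (h : s ≫ X.anchor = f ≫ c.map)
        (h' : f ≫ target c = g ≫ c.map),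
        X.smul s (composite f g h') (by rw [composite_map, h]) =
          X.smul (X.smul s f h) g (by rw [smul_anchor, h']) := by
  constructor
  · intro coassoc
    have eval_eq {T : E} (s : T ⟶ X.carrier) (f : T ⟶ c.dir) (h : s ≫ X.anchor = f ≫ c.map) :
        c.eval ((s ≫ X.coaction) ≫ duplicate c _) f
          (by rw [comp_duplicate_proj, X.comp_coaction_proj, h]) = X.smul s f h ≫ X.coaction := by
      simp only [Category.assoc, coassoc, X.eval_coaction_map]
    have smul_anchor {T : E} (s : T ⟶ X.carrier) (f : T ⟶ c.dir)
        (h : s ≫ X.anchor = f ≫ c.map) : X.smul s f h ≫ X.anchor = f ≫ target c := by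
      rw [← X.comp_coaction_proj, ← eval_eq, eval_duplicate_proj]
    refine ⟨smul_anchor, fun s f g h h' => ?_⟩
    have eval_eval := eval_eval_duplicate (s ≫ X.coaction) f g
      (by rw [comp_duplicate_proj, X.comp_coaction_proj, h]) h'
    rw [X.eval_coaction] at eval_eval
    refine eval_eval.symm.trans ((c.eval_congr (eval_eq s f h) rfl _ ?_).trans
      (X.eval_coaction _ _ _))
    rw [X.comp_coaction_proj, smul_anchor, h']
  · rintro ⟨smul_anchor, smul_composite⟩
    refine hom_ext_of_eval_eval c c ?_ (fun s f hu hv => ?_) fun s f g hu hv hu' hv' => ?_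
    · rw [comp_duplicate_proj, Category.assoc, map_proj]
    · simp only [← Category.assoc s X.coaction (duplicate c _), eval_duplicate_proj,
        X.eval_coaction_map, X.comp_coaction_proj, smul_anchor]
    · have h' : f ≫ target c = g ≫ c.map := by
        simpa only [X.eval_coaction_map, X.comp_coaction_proj, smul_anchor] using hv'
      simp only [← Category.assoc s X.coaction (duplicate c _), eval_eval_duplicate _ f g _ h',
        X.eval_coaction_map, X.eval_coaction]
      exact smul_composite s f g _ h'

theorem isAction_iff : c.internalCategory.IsAction X ↔
    X.coaction ≫ extract c _ = 𝟙 _ ∧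
      X.coaction ≫ duplicate c _ = X.coaction ≫ c.functor.map X.coaction := by
  rw [coaction_extract_iff, coaction_duplicate_iff]
  constructor
  · intro hX
    refine ⟨hX.smul_ident, hX.smul_anchor, fun s f g h h' => ?_⟩
    exact (X.smul_congr rfl (internalCategory_compElt f g h').symm _ _).trans
      (hX.smul_compElt s f g h h')
  · rintro ⟨smul_identity, smul_anchor, smul_composite⟩
    refine ⟨smul_anchor, smul_identity, fun s f g h h' => ?_⟩
    exact (X.smul_congr rfl (internalCategory_compElt f g h') _ _).trans
      (smul_composite s f g h h')

variable (c) in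
/-- The functor from actions of the internal category of `c` to `c`-coalgebras. -/
noncomputable def actionToCoalgebra : c.internalCategory.Action ⥤ c.comonad.Coalgebra where
  obj X :=
    { A := X.obj.carrier
      a := ArrowAction.coaction (p := c) X.obj
      counit := (isAction_iff.1 X.property).1
      coassoc := (isAction_iff.1 X.property).2 }
  map F := ⟨F.hom.hom, (ArrowAction.isEquivariant_iff_coaction F.hom.hom).1 F.hom.isEquivariant⟩

instance : (actionToCoalgebra c).Faithful where
  map_injective h :=
    ObjectProperty.hom_ext _ (ArrowAction.Hom.ext (congrArg Comonad.Coalgebra.Hom.f h))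

instance : (actionToCoalgebra c).Full where
  map_surjective F :=
    ⟨ObjectProperty.homMk ⟨F.f, (ArrowAction.isEquivariant_iff_coaction F.f).2 F.h⟩, rfl⟩

instance : (actionToCoalgebra c).EssSurj where
  mem_essImage X := by
    have coaction_eq := ArrowAction.coaction_ofCoaction (p := c) X.a
    have isAction : c.internalCategory.IsAction (ArrowAction.ofCoaction (p := c) X.a) :=
      isAction_iff.2 (by rw [coaction_eq]; exact ⟨X.counit, X.coassoc⟩)
    refine ⟨⟨_, isAction⟩, ⟨Comonad.Coalgebra.isoMk (Iso.refl X.A) ?_⟩⟩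
    exact (_ ≫= c.functor.map_id X.A).trans <| (Category.comp_id _).trans <|
      coaction_eq.trans (Category.id_comp X.a).symm

instance : (actionToCoalgebra c).IsEquivalence where

end Poly

end InternalPoly

theorem mainTheorem4 {E : Type u} [Category.{v} E] [HasFiniteLimits E]
    (c : InternalPoly.Poly E) [ComonObj c] :
    Nonempty (c.comonad.Coalgebra ≌ InternalPoly.InternalCopresheaf c.internalCategory) :=
  ⟨((InternalPoly.InternalCopresheaf.toAction c.internalCategory).asEquivalence.trans
    (InternalPoly.Poly.actionToCoalgebra c).asEquivalence).symm⟩
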